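/- **Theorem 1.2.** Let $n\ge 2$ and let $\Delta\subset\mathbb R^n$ be an $n$-dimensional polytope that is - *Delzant* (smooth): exactly $n$ edges meet at each vertex $v$; these edges have the form $\{v+tw_i : 0\le t\le T_i\}$ with $w_i\in\mathbb Z^n$; and $w_1,\dots,w_n$ can be chosen to be a basis of the lattice $\mathbb Z^n$; - *reflexive*: all vertices of $\Delta$ lie in $\mathbb Z^n$, the origin lies in the interior of $\Delta$, and $\Delta=\bigcap_F\{x\in\mathbb R^n : \langle x,l_F\rangle\le 1\}$, where $F$ runs over the facets of $\Delta$ and $l_F\in\mathbb Z^n$ is the primitive outward normal vector to the hyperplane spanned by $F$. Let $\Delta[i]$ be the set of $i$-dimensional faces of $\Delta$ (with $\Delta[n]=\{\Delta\}$), let $f_i=|\Delta[i]|$ for $0\le i\le n$, and let $$h_j=\sum_{i=0}^{j}(-1)^{j-i}\binom{n-i}{n-j}f_{n-i},\qquad 0\le j\le n.$$ Every edge $e\in\Delta[1]$, with endpoints $v_1,v_2$, has a well-defined relative length $l(e)>0$, given by $v_2-v_1=l(e)\,w$ with $w\in\mathbb Z^n$ primitive. The sum $\sum_{e\in\Delta[1]}l(e)$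 depends only on $(f_0,\dots,f_n)$; more precisely, $$\sum_{e\in\Delta[1]}l(e)=12f_2+(5-3n)f_1 .$$ In terms of $\mathbf h=(h_0,\dots,h_n)$, one has $\sum_{e\in\Delta[1]}l(e)=C(n,\mathbf h)$, where $$C(n,\mathbf h)=\begin{cases}12\displaystyle\sum_{k=1}^{m}k^2h_{m-k}-m\sum_{k=0}^{n}h_k & \text{if } n=2m \text{ is even},\\[2ex] 12\displaystyle\sum_{k=1}^{m}k(k+1)h_{m-k}-(m-1)\sum_{k=0}^{n}h_k & \text{if } n=2m+1 \text{ is odd}.\end{cases}$$ -/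

import Mathlib

noncomputable section

namespace DelzantReflexive

variable {n : ℕ}

/-- The integral vector `w ∈ ℤⁿ`, seen as a vector of `ℝⁿ`. -/
def toReal (w : Fin n → ℤ) : Fin n → ℝ := fun i => (w i : ℝ)

/-- `w ∈ ℤⁿ` is primitive: `w = m • u` with `u ∈ ℤⁿ` and `m ∈ ℤ` only for `m = ± 1`. -/
def IsPrimitive (w : Fin n → ℤ) : Prop :=
  ∀ (m : ℤ) (u : Fin n → ℤ), w = m • u → m = 1 ∨ m = -1

/-! ### Polytopes and their faces -/

/-- A (convex) polytope in `ℝⁿ`: the convex hull of a finite set of points. -/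
def IsPolytope (P : Set (Fin n → ℝ)) : Prop :=
  ∃ S : Finset (Fin n → ℝ), P = convexHull ℝ (S : Set (Fin n → ℝ))

/-- The dimension of a (nonempty) subset of `ℝⁿ`: the dimension of its affine span. -/
def dim (P : Set (Fin n → ℝ)) : ℕ := Module.finrank ℝ (vectorSpan ℝ P)

/-- The set of `i`-dimensional faces of `P`. A face is the nonempty set of points of `P` at which
some linear functional attains its maximum over `P`; the zero functional gives `P` itself. -/
def faces (P : Set (Fin n → ℝ)) (i : ℕ) : Set (Set (Fin n → ℝ)) :=
  {F | F.Nonempty ∧ IsExposed ℝ P F ∧ dim F = i}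

/-- The vertices of `P`: the points `v` such that `{v}` is a `0`-dimensional face. -/
def vertices (P : Set (Fin n → ℝ)) : Set (Fin n → ℝ) := {v | {v} ∈ faces P 0}

/-- The edges of `P` that contain the point `v`. -/
def edgesAt (P : Set (Fin n → ℝ)) (v : Fin n → ℝ) : Set (Set (Fin n → ℝ)) :=
  {e | e ∈ faces P 1 ∧ v ∈ e}

/-- A polytope has finitely many faces of each dimension. -/
theorem IsPolytope.finite_faces {P : Set (Fin n → ℝ)} (hP : IsPolytope P) (i : ℕ) :
    (faces P i).Finite := by
  obtain ⟨S, rfl⟩ := hP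
  have key : ∀ F ∈ faces (convexHull ℝ (S : Set (Fin n → ℝ))) i,
      convexHull ℝ ((S : Set (Fin n → ℝ)) ∩ F) = F := by
    rintro F ⟨-, hF, -⟩
    have hcomp : IsCompact F := hF.isCompact (S.finite_toSet.isCompact_convexHull ℝ)
    have hconv : Convex ℝ F := hF.convex (convex_convexHull ℝ _)
    apply subset_antisymm
    · exact convexHull_min Set.inter_subset_right hconv
    · have h1 : F.extremePoints ℝ ⊆ (S : Set (Fin n → ℝ)) ∩ F := fun x hx =>
        ⟨extremePoints_convexHull_subset (hF.isExtreme.extremePoints_subset_extremePoints hx),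
          hx.1⟩
      have h2 := closure_convexHull_extremePoints hcomp hconv
      rw [← h2]
      refine closure_minimal ?_ ?_
      · rw [h2]
        exact convexHull_mono h1
      · rw [h2]
        exact (S.finite_toSet.inter_of_left F).isClosed_convexHull ℝ
  refine Set.Finite.subset ((S.finite_toSet.powerset).image (fun T => convexHull ℝ T)) ?_
  intro F hF
  exact ⟨(S : Set (Fin n → ℝ)) ∩ F, Set.inter_subset_left, key F hF⟩

/-- The entry `f_i` of the `f`-vector: the number of `i`-dimensional faces. -/
def fVector (P : Set (Fin n → ℝ)) (i : ℕ) : ℕ := (faces P i).ncard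

/-- The entry `h_j`, `0 ≤ j ≤ n`, of the `h`-vector of a simple polytope of dimension `n`:
`h_j = ∑_{i=0}^{j} (-1)^{j-i} * binom(n-i, n-j) * f_{n-i}`. -/
def hVector (P : Set (Fin n → ℝ)) (j : ℕ) : ℤ :=
  ∑ i ∈ Finset.range (j + 1),
    (-1) ^ (j - i) * (Nat.choose (n - i) (n - j) : ℤ) * (fVector P (n - i) : ℤ)

/-! ### Delzant and reflexive polytopes -/

/-- The Delzant condition for an `n`-dimensional polytope `P` in `ℝⁿ`. -/
structure IsDelzant (P : Set (Fin n → ℝ)) : Prop where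
  /-- there are exactly `n` edges meeting at each vertex -/
  simple : ∀ v ∈ vertices P, (edgesAt P v).ncard = n
  /-- the edges meeting at a vertex `v` have the form `{v + t w | 0 ≤ t ≤ T}` with `w ∈ ℤⁿ` -/
  rational : ∀ v ∈ vertices P, ∀ e ∈ edgesAt P v, ∃ w : Fin n → ℤ, ∃ T : ℝ, 0 < T ∧
    e = segment ℝ v (v + T • toReal w)
  /-- at each vertex the directions `w` of the edges can be chosen to be a basis of `ℤⁿ` -/
  smooth : ∀ v ∈ vertices P, ∃ w : edgesAt P v → (Fin n → ℤ),
    (∀ e : edgesAt P v, ∃ T : ℝ, 0 < T ∧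
      (e : Set (Fin n → ℝ)) = segment ℝ v (v + T • toReal (w e))) ∧
    LinearIndependent ℤ w ∧ Submodule.span ℤ (Set.range w) = ⊤

/-- All vertices of `P` are integral. -/
def IsIntegral (P : Set (Fin n → ℝ)) : Prop :=
  ∀ v ∈ vertices P, ∃ u : Fin n → ℤ, v = toReal u

/-- `l ∈ ℤⁿ` is a primitive outward normal vector to a hyperplane `⟨x, l⟩ = m` that supports `P`
and cuts out the face `F`. -/
def IsPrimitiveOutwardNormal (P F : Set (Fin n → ℝ)) (l : Fin n → ℤ) : Prop :=
  IsPrimitive l ∧ ∃ m : ℝ, (∀ x ∈ P, x ⬝ᵥ toReal l ≤ m) ∧ F = {x ∈ P | x ⬝ᵥ toReal l = m}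

/-- An `n`-dimensional polytope `P` in `ℝⁿ` is reflexive if it is integral, contains `0` in its
interior, and `P = ⋂_F {x | ⟨x, l_F⟩ ≤ 1}`, where `F` runs over the facets of `P` and `l_F ∈ ℤⁿ` is
the primitive outward normal vector to the hyperplane defining `F`. -/
structure IsReflexive (P : Set (Fin n → ℝ)) : Prop where
  integral : IsIntegral P
  zero_mem_interior : (0 : Fin n → ℝ) ∈ interior P
  eq_iInter : ∃ l : faces P (n - 1) → (Fin n → ℤ),
    (∀ F : faces P (n - 1), IsPrimitiveOutwardNormal P F (l F)) ∧
    P = ⋂ F : faces P (n - 1), {x | x ⬝ᵥ toReal (l F) ≤ 1}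

/-! ### Relative length -/

/-- `l` is the relative length of `e`: `e` is a segment from `v₁` to `v₂` and `v₂ - v₁ = l • w` for
a primitive `w ∈ ℤⁿ` and a real number `l > 0`. -/
def IsRelativeLength (e : Set (Fin n → ℝ)) (l : ℝ) : Prop :=
  ∃ (v₁ v₂ : Fin n → ℝ) (w : Fin n → ℤ), e = segment ℝ v₁ v₂ ∧ IsPrimitive w ∧ 0 < l ∧
    v₂ - v₁ = l • toReal w

open Classical in
/-- The relative length of `e` (with the value `0` if `e` has none). -/
def relativeLength (e : Set (Fin n → ℝ)) : ℝ :=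
  if h : ∃ l : ℝ, IsRelativeLength e l then h.choose else 0

theorem IsPrimitive.length_unique {w w' : Fin n → ℤ} (hw : IsPrimitive w) (hw' : IsPrimitive w')
    {l l' : ℝ} (hl : 0 < l) (hl' : 0 < l') (h : l • toReal w = l' • toReal w') : l = l' := by
  have hc : ∀ i, l * (w i : ℝ) = l' * (w' i : ℝ) := fun i => congrFun h i
  have hne : ∃ i, w i ≠ 0 := by
    by_contra hcon
    push Not at hcon
    have := hw 0 0 (by ext i; simp [hcon i])
    omega
  obtain ⟨j, hj⟩ := hne
  have hx : ∀ i, w j * w' i = w' j * w i := by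
    intro i
    have h1 := hc i
    have h2 := hc j
    have : l * l' * ((w j : ℝ) * w' i) = l * l' * ((w' j : ℝ) * w i) := by
      linear_combination (l * w j) * (-h1) + (l * w i) * h2
    have := mul_left_cancel₀ (mul_pos hl hl').ne' this
    exact_mod_cast this
  have hgpos : 0 < Int.gcd (w j) (w' j) :=
    Nat.pos_of_ne_zero fun h0 => hj (Int.gcd_eq_zero_iff.mp h0).1
  obtain ⟨p, q, hpq, hp, hq⟩ := Int.exists_gcd_one hgpos
  set g : ℤ := (Int.gcd (w j) (w' j) : ℤ) with hg
  have hg0 : g ≠ 0 := by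
    rw [hg]
    exact_mod_cast hgpos.ne'
  have hy : ∀ i, p * w' i = q * w i := by
    intro i
    have h1 := hx i
    rw [hp, hq] at h1
    exact mul_left_cancel₀ hg0 (by linear_combination h1)
  obtain ⟨a, b, hab⟩ := Int.isCoprime_iff_gcd_eq_one.mpr hpq
  have hp1 := hw p (a • w + b • w') (by
    ext i
    simp only [Pi.add_apply, Pi.smul_apply, smul_eq_mul]
    linear_combination (-(w i)) * hab - b * hy i)
  have hq1 := hw' q (a • w + b • w') (by
    ext i
    simp only [Pi.add_apply, Pi.smul_apply, smul_eq_mul]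
    linear_combination (-(w' i)) * hab + a * hy i)
  have hlq : l * (p : ℝ) = l' * (q : ℝ) := by
    have h1 := hc j
    have hg0' : (g : ℝ) ≠ 0 := by exact_mod_cast hg0
    rw [hp, hq] at h1
    push_cast at h1
    exact mul_right_cancel₀ hg0' (by linear_combination h1)
  rcases hp1 with rfl | rfl <;> rcases hq1 with rfl | rfl <;> push_cast at hlq <;> linarith

/-- The relative length of a segment is unique. -/
theorem IsRelativeLength.unique {e : Set (Fin n → ℝ)} {l l' : ℝ} (h : IsRelativeLength e l)
    (h' : IsRelativeLength e l') : l = l' := by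
  obtain ⟨a, b, w, rfl, hw, hl, hab⟩ := h
  obtain ⟨c, d, w', he, hw', hl', hcd⟩ := h'
  have key : ∀ {a b c d : Fin n → ℝ}, segment ℝ a b = segment ℝ c d →
      ∃ s : ℝ, |s| ≤ 1 ∧ b - a = s • (d - c) := by
    intro a b c d h
    have ha : a ∈ segment ℝ c d := h ▸ left_mem_segment ℝ a b
    have hb : b ∈ segment ℝ c d := h ▸ right_mem_segment ℝ a b
    rw [segment_eq_image'] at ha hb
    obtain ⟨s, hs, rfl⟩ := ha
    obtain ⟨t, ht, rfl⟩ := hb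
    refine ⟨t - s, abs_le.mpr ⟨by linarith [hs.1, hs.2, ht.1, ht.2],
      by linarith [hs.1, hs.2, ht.1, ht.2]⟩, ?_⟩
    simp only [sub_smul]
    abel
  obtain ⟨s, hs, h1⟩ := key he
  obtain ⟨t, ht, h2⟩ := key he.symm
  have hne : b - a ≠ 0 := by
    rw [hab]
    intro h0
    rcases smul_eq_zero.mp h0 with h0 | h0
    · exact hl.ne' h0
    · have hw0 : w = 0 := by
        ext i
        have := congrFun h0 i
        simpa [toReal] using this
      have := hw 0 0 (by simp [hw0])
      omega
  have hst : s * t = 1 := by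
    have h3 : (s * t) • (b - a) = (1 : ℝ) • (b - a) := by
      rw [mul_smul, ← h2, ← h1, one_smul]
    exact smul_left_injective ℝ hne h3
  have hs1 : s = 1 ∨ s = -1 := by
    have h4 : |s| * |t| = 1 := by rw [← abs_mul, hst, abs_one]
    have h5 : |s| = 1 := by nlinarith [abs_nonneg s, abs_nonneg t]
    exact eq_or_eq_neg_of_abs_eq h5
  rcases hs1 with rfl | rfl
  · refine hw.length_unique hw' hl hl' ?_
    rw [← hab, ← hcd, h1, one_smul]
  · have hneg : IsPrimitive (-w') := fun m u hmu =>
      hw' m (-u) (by rw [smul_neg, ← hmu, neg_neg])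
    refine hw.length_unique hneg hl hl' ?_
    have h6 : toReal (-w') = -toReal w' := by
      ext i
      simp [toReal]
    rw [← hab, h1, hcd, h6]
    simp

theorem IsRelativeLength.relativeLength_eq {e : Set (Fin n → ℝ)} {l : ℝ}
    (h : IsRelativeLength e l) : relativeLength e = l := by
  have hex : ∃ l : ℝ, IsRelativeLength e l := ⟨l, h⟩
  rw [relativeLength, dif_pos hex]
  exact hex.choose_spec.unique h

/-! ### The expression in the `h`-vector -/

/-- `C(n, h)`: with `m = ⌊n / 2⌋` it is
`12 ∑_{k=1}^m k² h_{m-k} - m ∑_{k=0}^n h_k` for even `n` and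
`12 ∑_{k=1}^m k (k+1) h_{m-k} - (m-1) ∑_{k=0}^n h_k` for odd `n`. -/
def hExpression (n : ℕ) (h : ℕ → ℤ) : ℤ :=
  if Even n then
    12 * ∑ k ∈ Finset.Icc 1 (n / 2), (k : ℤ) ^ 2 * h (n / 2 - k)
      - ((n / 2 : ℕ) : ℤ) * ∑ k ∈ Finset.range (n + 1), h k
  else
    12 * ∑ k ∈ Finset.Icc 1 (n / 2), (k : ℤ) * ((k : ℤ) + 1) * h (n / 2 - k)
      - (((n / 2 : ℕ) : ℤ) - 1) * ∑ k ∈ Finset.range (n + 1), h k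

end DelzantReflexive

end

/-! ### Convex geometry at a vertex, and the lattice bases supplied by smoothness. -/

noncomputable section

namespace DelzantReflexive

variable {n : ℕ}

/-! ### Vertices and edges of polytopes -/

/-! At a vertex `v` the primitive edge directions `w_e` form a lattice basis. Reflexivity places
every facet hyperplane through `v` at lattice distance one from the origin, so each coordinate of
`v` in this basis is `-1`, that is, `v = -∑ w_e`. Subtracting this formula at the two ends `v`, `u`
of an edge `e` expresses `l(e) w_e = u - v` as a difference of sums of directions. The edge `e`
itself contributes `2 w_e`. The other edges at `v`, and likewise at `u`, correspond to the 2-faces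
`Q` containing `e`, and inside `Q` the two neighbouring directions differ by a multiple `b(Q,e)
w_e`. Hence `l(e) = 2 + ∑_Q b(Q,e)`.

For a smooth polygon with `k` edges the numbers `b(Q,e)` sum to `12 - 3k`, the identity known from
self-intersections on toric surfaces. An edge lies in `n - 1` two-dimensional faces, so the total
length is `2 f₁ + 12 f₂ - 3(n-1) f₁`.

The polygon identity (`exists_functional_sum_ratio`) is proved here with Dedekind sums. A functional
`ξ` nonzero on all edge directions turns `∑ b` into a sum over vertices of `ξ(w')/ξ(w) +
ξ(w)/ξ(w')`. By reciprocity this equals a difference of a potential on primitive vectors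
(`exists_planar_potential`), minus 3, plus 6 if `ξ` has the same sign on both edges. The potential
telescopes around the polygon, and equal signs occur exactly at the minimum and the maximum of `ξ`.

For the `h`-vector, a generic functional `l` assigns each face to its lowest vertex, so `f_i = ∑_v
choose (a v) i`, where `a v` counts ascending edges. Then `h_j` counts the vertices with `a v = j`,
and passing to `-l` gives the symmetry `h_j = h_{n-j}`. Averaged over `l` and `-l`, both expressions
become half of `∑_v (3(n - 2 a v)² - n)`. -/

/-- An extreme point of the convex hull of a finite set is exposed. -/
theorem exists_dual_lt_of_mem_extremePoints {T : Set (Fin n → ℝ)} (hT : T.Finite)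
    {x : Fin n → ℝ} (hx : x ∈ (convexHull ℝ T).extremePoints ℝ) :
    ∃ g : StrongDual ℝ (Fin n → ℝ), ∀ y ∈ convexHull ℝ T, y ≠ x → g y < g x := by
  have hxT : x ∈ T := extremePoints_convexHull_subset hx
  have hx' : x ∉ convexHull ℝ (T \ {x}) := fun h =>
    (((convex_convexHull ℝ T).mem_extremePoints_iff_mem_sdiff_convexHull_sdiff).1 hx).2
      (convexHull_mono (Set.sdiff_subset_sdiff_left (subset_convexHull ℝ T)) h)
  obtain ⟨g, u, hg, hu⟩ := geometric_hahn_banach_closed_point (convex_convexHull ℝ (T \ {x}))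
    ((hT.subset Set.sdiff_subset).isClosed_convexHull ℝ) hx'
  refine ⟨g, fun y hy hyx => ?_⟩
  have hins : T = insert x (T \ {x}) := by simp [Set.insert_eq_of_mem hxT]
  rcases (T \ {x}).eq_empty_or_nonempty with hE | hE
  · rw [hins, hE] at hy
    simp at hy
    exact absurd hy hyx
  · rw [hins, convexHull_insert hE, convexJoin_singleton_left, Set.mem_iUnion₂] at hy
    obtain ⟨z, hz, a, b, ha, hb, hab, rfl⟩ := hy
    have hb0 : 0 < b := by
      refine lt_of_le_of_ne hb fun h => hyx ?_
      subst h
      simp [show a = 1 by linarith]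
    have := (hg z hz).trans hu
    obtain rfl : a = 1 - b := by linarith
    simp only [map_add, map_smul, smul_eq_mul]
    nlinarith [mul_lt_mul_of_pos_left this hb0]

theorem IsPolytope.isCompact {P : Set (Fin n → ℝ)} (hP : IsPolytope P) : IsCompact P := by
  obtain ⟨S, rfl⟩ := hP
  exact S.finite_toSet.isCompact_convexHull ℝ

theorem IsPolytope.convex {P : Set (Fin n → ℝ)} (hP : IsPolytope P) : Convex ℝ P := by
  obtain ⟨S, rfl⟩ := hP
  exact convex_convexHull ℝ _

theorem dim_singleton (v : Fin n → ℝ) : dim ({v} : Set (Fin n → ℝ)) = 0 := by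
  simp [dim]

/-- For a polytope, extreme points are exposed. Extremality is the form in which Krein–Milman
produces vertices and in which they pass from a face to `P`. -/
theorem IsPolytope.mem_vertices_iff {P : Set (Fin n → ℝ)} (hP : IsPolytope P) {v : Fin n → ℝ} :
    v ∈ vertices P ↔ v ∈ P.extremePoints ℝ := by
  constructor
  · rintro ⟨-, h, -⟩
    exact isExtreme_singleton.1 h.isExtreme
  · intro hv
    refine ⟨Set.singleton_nonempty v, fun _ => ?_, dim_singleton v⟩
    have hvP := hv.1
    obtain ⟨S, rfl⟩ := hP
    obtain ⟨g, hg⟩ := exists_dual_lt_of_mem_extremePoints S.finite_toSet hv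
    refine ⟨g, ?_⟩
    ext y
    simp only [Set.mem_singleton_iff, Set.mem_ofPred_eq]
    constructor
    · intro hyv
      rw [hyv]
      refine ⟨hvP, fun y hy => ?_⟩
      rcases eq_or_ne y v with h | h
      · rw [h]
      · exact (hg y hy h).le
    · rintro ⟨hy, hy'⟩
      by_contra h
      exact absurd (hy' v hvP) (not_le.2 (hg y hy h))

/-- A polytope is contained in the cone with apex a vertex `v` spanned by the edges at `v`. -/
theorem IsPolytope.sub_mem_of_edges {P : Set (Fin n → ℝ)} (hP : IsPolytope P)
    {v : Fin n → ℝ} (hv : v ∈ vertices P) (C : PointedCone ℝ (Fin n → ℝ))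
    (hC : ∀ e ∈ edgesAt P v, ∀ y ∈ e, y - v ∈ C) {y : Fin n → ℝ} (hy : y ∈ P) : y - v ∈ C := by
  have hv' := hP.mem_vertices_iff.1 hv
  obtain ⟨S, rfl⟩ := hP
  obtain ⟨f, hf⟩ := exists_dual_lt_of_mem_extremePoints S.finite_toSet hv'
  -- Vertex figure: the rays from `v` to the other generators are rescaled to meet the hyperplane `f
  -- = -1`. Its hull is compact, so it suffices to show that its extreme points are edge directions.
  set K : Set (Fin n → ℝ) :=
    (fun x => (f v - f x)⁻¹ • (x - v)) '' ((S : Set (Fin n → ℝ)) \ {v}) with hK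
  have hKfin : K.Finite := (S.finite_toSet.subset Set.sdiff_subset).image _
  have hlt : ∀ s ∈ (S : Set (Fin n → ℝ)) \ {v}, 0 < f v - f s := fun s hs =>
    sub_pos.2 (hf s (subset_convexHull ℝ _ hs.1) hs.2)
  have hKf : ∀ k ∈ convexHull ℝ K, f k = -1 := by
    have h1 : convexHull ℝ K ⊆ {k | f k = -1} := by
      refine convexHull_min ?_ (convex_hyperplane f.toLinearMap.isLinear _)
      rintro _ ⟨s, hs, rfl⟩
      have := (hlt s hs).ne'
      simp only [Set.mem_ofPred_eq, map_smul, map_sub, smul_eq_mul]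
      field_simp
      ring
    exact fun k hk => h1 hk
  have hcone : ∀ (D : PointedCone ℝ (Fin n → ℝ)), (∀ k ∈ K, k ∈ D) →
      ∀ y ∈ convexHull ℝ (S : Set (Fin n → ℝ)), y - v ∈ D := by
    intro D hD
    have hconv : Convex ℝ ((fun y => y - v) ⁻¹' (D : Set (Fin n → ℝ))) := by
      have := D.convex.translate_preimage_left (-v)
      simpa [sub_eq_add_neg] using this
    refine fun y hy => (convexHull_min ?_ hconv) hy
    intro s hs
    rcases eq_or_ne s v with rfl | h
    · simp
    · have h1 := D.smul_mem (hlt s ⟨hs, h⟩).le (hD _ ⟨s, ⟨hs, h⟩, rfl⟩)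
      simp only at h1
      rwa [smul_inv_smul₀ (hlt s ⟨hs, h⟩).ne'] at h1
  have hext : ∀ x ∈ (convexHull ℝ K).extremePoints ℝ, x ∈ C := by
    intro x hx
    obtain ⟨g, hg⟩ := exists_dual_lt_of_mem_extremePoints hKfin hx
    obtain ⟨s, hs, hsx⟩ := extremePoints_convexHull_subset hx
    have hxf := hKf x hx.1
    -- Since `f = -1` on the vertex figure, this homogeneous functional restricts there to `g - g
    -- x`, which is zero at `x` and negative elsewhere.
    set ψ : StrongDual ℝ (Fin n → ℝ) := g + g x • f with hψ
    have hψx : ψ x = 0 := by simp [hψ, hxf]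
    -- This cone meets `ψ = 0` only in the line through `x`. As it contains `P - v`, the face of `P`
    -- on which `ψ` is maximal lies in a line and is therefore an edge.
    let D : PointedCone ℝ (Fin n → ℝ) :=
      { carrier := {z | ψ z ≤ 0 ∧ (ψ z = 0 → ∃ c : ℝ, z = c • x)}
        zero_mem' := ⟨by simp, fun _ => ⟨0, by simp⟩⟩
        add_mem' := by
          rintro a b ⟨ha, ha'⟩ ⟨hb, hb'⟩
          refine ⟨by rw [map_add]; linarith, fun h => ?_⟩
          rw [map_add] at h
          obtain ⟨c, hc⟩ := ha' (by linarith)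
          obtain ⟨d, hd⟩ := hb' (by linarith)
          exact ⟨c + d, by rw [hc, hd, add_smul]⟩
        smul_mem' := by
          rintro ⟨c, hc⟩ a ⟨ha, ha'⟩
          have hs : ψ ((⟨c, hc⟩ : {c : ℝ // 0 ≤ c}) • a) = c * ψ a := by
            change ψ (c • a) = _
            simp
          refine ⟨by rw [hs]; exact mul_nonpos_of_nonneg_of_nonpos hc ha, fun h => ?_⟩
          rw [hs] at h
          rcases mul_eq_zero.1 h with h | h
          · exact ⟨0, by change c • a = _; simp [h]⟩
          · obtain ⟨d, hd⟩ := ha' h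
            exact ⟨c * d, by change c • a = _; rw [hd, mul_smul]⟩ }
    have hD := hcone D (fun k hk => by
      have hk' := subset_convexHull ℝ K hk
      have hψk : ψ k = g k - g x := by simp [hψ, hKf k hk', sub_eq_add_neg]
      rcases eq_or_ne k x with rfl | h
      · exact ⟨by rw [hψx], fun _ => ⟨1, by simp⟩⟩
      · have := hg k hk' h
        exact ⟨by rw [hψk]; linarith, fun h0 => by rw [hψk] at h0; linarith⟩)
    set e : Set (Fin n → ℝ) :=
      {y ∈ convexHull ℝ (S : Set (Fin n → ℝ)) |
        ∀ z ∈ convexHull ℝ (S : Set (Fin n → ℝ)), ψ z ≤ ψ y} with he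
    have hve : v ∈ e := ⟨hv'.1, fun z hz => by
      have := (hD z hz).1
      rw [map_sub] at this
      linarith⟩
    have hsv : s - v = (f v - f s) • x := by
      rw [← hsx, smul_inv_smul₀ (hlt s hs).ne']
    have hψs : ψ s = ψ v := by
      have : ψ (s - v) = 0 := by rw [hsv, map_smul, hψx, smul_zero]
      rw [map_sub] at this
      linarith
    have hse : s ∈ e := ⟨subset_convexHull ℝ _ hs.1, fun z hz => by rw [hψs]; exact hve.2 z hz⟩
    have hx0 : x ≠ 0 := by
      rintro rfl
      simp at hxf
    have hline : ∀ y ∈ e, ∃ c : ℝ, y - v = c • x := fun y hy =>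
      (hD y hy.1).2 (by
        have h1 := hy.2 v hv'.1
        have h2 := hve.2 y hy.1
        rw [map_sub]
        linarith)
    have hspan : vectorSpan ℝ e = Submodule.span ℝ {x} := by
      rw [vectorSpan_eq_span_vsub_set_right ℝ hve]
      apply le_antisymm
      · rw [Submodule.span_le]
        rintro _ ⟨y, hy, rfl⟩
        obtain ⟨c, hc⟩ := hline y hy
        simp only [vsub_eq_sub, hc]
        exact Submodule.smul_mem _ _ (Submodule.mem_span_singleton_self x)
      · rw [Submodule.span_singleton_le_iff_mem]
        have h1 : s - v ∈ Submodule.span ℝ ((fun y => y -ᵥ v) '' e) :=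
          Submodule.subset_span ⟨s, hse, rfl⟩
        rw [hsv] at h1
        have h2 := Submodule.smul_mem _ (f v - f s)⁻¹ h1
        rwa [inv_smul_smul₀ (hlt s hs).ne'] at h2
    have hedge : e ∈ edgesAt (convexHull ℝ (S : Set (Fin n → ℝ))) v := by
      refine ⟨⟨⟨v, hve⟩, fun _ => ⟨ψ, rfl⟩, ?_⟩, hve⟩
      rw [dim, hspan, finrank_span_singleton hx0]
    rw [← hsx]
    exact C.smul_mem (inv_nonneg.2 (hlt s hs).le) (hC e hedge s hse)
  refine hcone C (fun k hk => ?_) y hy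
  have hsub : convexHull ℝ K ⊆ (C : Set (Fin n → ℝ)) := by
    rw [← closure_convexHull_extremePoints (hKfin.isCompact_convexHull ℝ)
      (convex_convexHull ℝ K), IsClosed.closure_eq]
    · exact convexHull_min hext C.convex
    · exact (hKfin.subset extremePoints_convexHull_subset).isClosed_convexHull ℝ
  exact hsub (subset_convexHull ℝ K hk)

/-! ### Lattice bases -/

theorem toReal_add (u w : Fin n → ℤ) : toReal (u + w) = toReal u + toReal w := by
  ext i; simp [toReal]

theorem toReal_neg (u : Fin n → ℤ) : toReal (-u) = -toReal u := by
  ext i; simp [toReal]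

theorem toReal_smul (m : ℤ) (u : Fin n → ℤ) : toReal (m • u) = (m : ℝ) • toReal u := by
  ext i; simp [toReal]

theorem toReal_injective : Function.Injective (toReal : (Fin n → ℤ) → (Fin n → ℝ)) := by
  intro u w h
  ext i
  have := congrFun h i
  simpa [toReal] using this

/-- `toReal` as an additive map. -/
def toRealHom : (Fin n → ℤ) →ₗ[ℤ] (Fin n → ℝ) where
  toFun := toReal
  map_add' := toReal_add
  map_smul' m u := by
    ext i
    simp [toReal]

theorem toReal_sum {ι : Type*} (s : Finset ι) (u : ι → (Fin n → ℤ)) :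
    toReal (∑ i ∈ s, u i) = ∑ i ∈ s, toReal (u i) :=
  map_sum toRealHom u s

/-- The real basis attached to a basis of the lattice `ℤⁿ`. -/
theorem exists_basis_toReal {ι : Type*} [Fintype ι] (b : Module.Basis ι ℤ (Fin n → ℤ)) :
    ∃ B : Module.Basis ι ℝ (Fin n → ℝ), (∀ i, B i = toReal (b i)) ∧
      ∀ u i, B.repr (toReal u) i = (b.repr u i : ℝ) := by
  have hexp : ∀ u : Fin n → ℤ, toReal u = ∑ i, (b.repr u i : ℝ) • toReal (b i) := by
    intro u
    conv_lhs => rw [← b.sum_repr u, toReal_sum]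
    simp only [toReal_smul]
  have hspan : ⊤ ≤ Submodule.span ℝ (Set.range fun i => toReal (b i)) := by
    rw [← (Pi.basisFun ℝ (Fin n)).span_eq, Submodule.span_le]
    rintro _ ⟨j, rfl⟩
    have : (Pi.basisFun ℝ (Fin n)) j = toReal (Pi.single j 1) := by
      ext i
      simp [toReal, Pi.single_apply]
    rw [this, hexp]
    exact Submodule.sum_mem _ fun i _ => Submodule.smul_mem _ _ (Submodule.subset_span ⟨i, rfl⟩)
  have hcard : Fintype.card ι = Module.finrank ℝ (Fin n → ℝ) := by
    rw [← Module.finrank_eq_card_basis b]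
    simp
  refine ⟨basisOfTopLeSpanOfCardEqFinrank _ hspan hcard, fun i => by simp, fun u i => ?_⟩
  classical
  rw [hexp u, map_sum, Finset.sum_apply']
  have hB : ∀ j, (basisOfTopLeSpanOfCardEqFinrank _ hspan hcard).repr (toReal (b j)) =
      Finsupp.single j 1 := fun j => by
    rw [← Module.Basis.repr_self (basisOfTopLeSpanOfCardEqFinrank _ hspan hcard) j]
    simp
  simp only [map_smul, hB]
  simp [Finsupp.single_apply]

/-! ### Framings -/

/-- The local description of a Delzant polytope: at each vertex `v`, the edges `e` have primitive
directions `dir v e`, which form a lattice basis with dual basis `coord v e`. -/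
structure Framing (P : Set (Fin n → ℝ)) where
  polytope : IsPolytope P
  card_edges : ∀ v ∈ vertices P, (edgesAt P v).ncard = n
  dir : (Fin n → ℝ) → Set (Fin n → ℝ) → (Fin n → ℤ)
  coord : (Fin n → ℝ) → Set (Fin n → ℝ) → (Fin n → ℝ) →ₗ[ℝ] ℝ
  len : (Fin n → ℝ) → Set (Fin n → ℝ) → ℝ
  coord_self : ∀ v ∈ vertices P, ∀ e ∈ edgesAt P v, coord v e (toReal (dir v e)) = 1
  coord_ne : ∀ v ∈ vertices P, ∀ e ∈ edgesAt P v, ∀ e' ∈ edgesAt P v, e ≠ e' →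
    coord v e (toReal (dir v e')) = 0
  coord_int : ∀ v e u, ∃ k : ℤ, coord v e (toReal u) = k
  coord_ext : ∀ v ∈ vertices P, ∀ x y : Fin n → ℝ, (∀ e ∈ edgesAt P v, coord v e x = coord v e y) →
    x = y
  coord_nonneg : ∀ v ∈ vertices P, ∀ e ∈ edgesAt P v, ∀ x ∈ P, 0 ≤ coord v e (x - v)
  len_pos : ∀ v ∈ vertices P, ∀ e ∈ edgesAt P v, 0 < len v e
  eq_segment : ∀ v ∈ vertices P, ∀ e ∈ edgesAt P v,
    e = segment ℝ v (v + len v e • toReal (dir v e))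

theorem edgesAt_finite {P : Set (Fin n → ℝ)} (hP : IsPolytope P) (v : Fin n → ℝ) :
    (edgesAt P v).Finite :=
  (hP.finite_faces 1).subset fun _ h => h.1

/-- The coordinates are dual to the smooth basis. Only their nonnegativity on `P - v` needs
geometry: it is clear on the edges at `v`, and `P - v` lies in the cone they span. -/
theorem exists_framing_at {P : Set (Fin n → ℝ)} (hP : IsPolytope P) (hD : IsDelzant P)
    {v : Fin n → ℝ} (hv : v ∈ vertices P) :
    ∃ (dir : Set (Fin n → ℝ) → (Fin n → ℤ)) (coord : Set (Fin n → ℝ) → (Fin n → ℝ) →ₗ[ℝ] ℝ)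
      (len : Set (Fin n → ℝ) → ℝ),
      (∀ e ∈ edgesAt P v, coord e (toReal (dir e)) = 1) ∧
      (∀ e ∈ edgesAt P v, ∀ e' ∈ edgesAt P v, e ≠ e' → coord e (toReal (dir e')) = 0) ∧
      (∀ e u, ∃ k : ℤ, coord e (toReal u) = k) ∧
      (∀ x y : Fin n → ℝ, (∀ e ∈ edgesAt P v, coord e x = coord e y) → x = y) ∧
      (∀ e ∈ edgesAt P v, ∀ x ∈ P, 0 ≤ coord e (x - v)) ∧
      (∀ e ∈ edgesAt P v, 0 < len e) ∧
      (∀ e ∈ edgesAt P v, e = segment ℝ v (v + len e • toReal (dir e))) := by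
  classical
  obtain ⟨w, hw, hind, hspan⟩ := hD.smooth v hv
  choose T hT hseg using hw
  have : Fintype (edgesAt P v) := (edgesAt_finite hP v).fintype
  obtain ⟨B, hB, hBint⟩ := exists_basis_toReal (Module.Basis.mk hind hspan.ge)
  simp only [Module.Basis.mk_apply] at hB
  let dir : Set (Fin n → ℝ) → (Fin n → ℤ) := fun e => if h : e ∈ edgesAt P v then w ⟨e, h⟩ else 0
  let len : Set (Fin n → ℝ) → ℝ := fun e => if h : e ∈ edgesAt P v then T ⟨e, h⟩ else 0
  let coord : Set (Fin n → ℝ) → (Fin n → ℝ) →ₗ[ℝ] ℝ := fun e =>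
    if h : e ∈ edgesAt P v then B.coord ⟨e, h⟩ else 0
  have hdir : ∀ e (h : e ∈ edgesAt P v), dir e = w ⟨e, h⟩ := fun e h => dif_pos h
  have hlen : ∀ e (h : e ∈ edgesAt P v), len e = T ⟨e, h⟩ := fun e h => dif_pos h
  have hcoord : ∀ e (h : e ∈ edgesAt P v), coord e = B.coord ⟨e, h⟩ := fun e h => dif_pos h
  have hsegm : ∀ e ∈ edgesAt P v, e = segment ℝ v (v + len e • toReal (dir e)) := by
    intro e he
    rw [hdir e he, hlen e he]
    exact hseg ⟨e, he⟩
  have hcd : ∀ e (h : e ∈ edgesAt P v) e' (h' : e' ∈ edgesAt P v),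
      coord e (toReal (dir e')) = if e = e' then 1 else 0 := by
    intro e h e' h'
    rw [hcoord e h, hdir e' h', ← hB]
    simp [Finsupp.single_apply, eq_comm]
  refine ⟨dir, coord, len, ?_, ?_, ?_, ?_, ?_, ?_, hsegm⟩
  · intro e he
    rw [hcd e he e he, if_pos rfl]
  · intro e he e' he' hne
    rw [hcd e he e' he', if_neg hne]
  · intro e u
    by_cases h : e ∈ edgesAt P v
    · rw [hcoord e h]
      exact ⟨_, hBint u _⟩
    · exact ⟨0, by simp [coord, h]⟩
  · intro x y h
    refine B.ext_elem fun i => ?_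
    have := h i i.2
    rwa [hcoord i i.2] at this
  · intro e he x hx
    let C : PointedCone ℝ (Fin n → ℝ) := (PointedCone.positive ℝ ℝ).comap (coord e)
    refine hP.sub_mem_of_edges hv C ?_ hx
    intro e' he' y hy
    rw [hsegm e' he', segment_eq_image'] at hy
    obtain ⟨t, ht, rfl⟩ := hy
    simp only [C, PointedCone.mem_comap, PointedCone.mem_positive, add_sub_cancel_left, map_smul,
      hcd e he e' he']
    have : 0 ≤ len e' := by rw [hlen e' he']; exact (hT _).le
    simp only [smul_eq_mul]
    split_ifs
    · exact mul_nonneg ht.1 (mul_nonneg this zero_le_one)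
    · simp
  · intro e he
    rw [hlen e he]
    exact hT _

theorem exists_framing {P : Set (Fin n → ℝ)} (hP : IsPolytope P) (hD : IsDelzant P) :
    Nonempty (Framing P) := by
  classical
  choose! d c l h using fun v (hv : v ∈ vertices P) => exists_framing_at hP hD hv
  exact ⟨{
    polytope := hP
    card_edges := hD.simple
    dir := d
    -- The default value zero lets integrality of coordinates hold at every `v`, not only at
    -- vertices.
    coord := fun v e => if v ∈ vertices P then c v e else 0
    len := l
    coord_self := fun v hv => by simpa [hv] using (h v hv).1
    coord_ne := fun v hv => by simpa [hv] using (h v hv).2.1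
    coord_int := fun v e u => by
      by_cases hv : v ∈ vertices P
      · simpa [hv] using (h v hv).2.2.1 e u
      · exact ⟨0, by simp [hv]⟩
    coord_ext := fun v hv => by simpa [hv] using (h v hv).2.2.2.1
    coord_nonneg := fun v hv => by simpa [hv] using (h v hv).2.2.2.2.1
    len_pos := fun v hv => (h v hv).2.2.2.2.2.1
    eq_segment := fun v hv => (h v hv).2.2.2.2.2.2 }⟩

end DelzantReflexive

end

/-! ### Faces of a simple polytope described by the edges at one of their vertices. -/

noncomputable section

namespace DelzantReflexive

variable {n : ℕ}

/-! ### Faces through a vertex -/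

theorem vertices_finite {P : Set (Fin n → ℝ)} (hP : IsPolytope P) : (vertices P).Finite := by
  refine Set.Finite.of_finite_image (f := fun v => ({v} : Set (Fin n → ℝ))) ?_
    Set.singleton_injective.injOn
  refine (hP.finite_faces 0).subset ?_
  rintro _ ⟨v, hv, rfl⟩
  exact hv

namespace Framing

variable {P : Set (Fin n → ℝ)} (fr : Framing P)

/-- The finset of vertices. -/
def verts : Finset (Fin n → ℝ) := (vertices_finite fr.polytope).toFinset

/-- The finset of `i`-dimensional faces. -/
def faceSet (i : ℕ) : Finset (Set (Fin n → ℝ)) := (fr.polytope.finite_faces i).toFinset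

/-- The finset of edges at `v`. -/
def edges (v : Fin n → ℝ) : Finset (Set (Fin n → ℝ)) := (edgesAt_finite fr.polytope v).toFinset

open Classical in
/-- The finset of edges at `v` contained in `F`. -/
def edgesIn (F : Set (Fin n → ℝ)) (v : Fin n → ℝ) : Finset (Set (Fin n → ℝ)) :=
  (fr.edges v).filter (· ⊆ F)

/-- The direction of an edge as a real vector. -/
def rdir (v : Fin n → ℝ) (e : Set (Fin n → ℝ)) : Fin n → ℝ := toReal (fr.dir v e)

@[simp] theorem mem_verts {v : Fin n → ℝ} : v ∈ fr.verts ↔ v ∈ vertices P := by simp [verts]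

@[simp] theorem mem_faceSet {i : ℕ} {F : Set (Fin n → ℝ)} :
    F ∈ fr.faceSet i ↔ F ∈ faces P i := by simp [faceSet]

@[simp] theorem mem_edges {v : Fin n → ℝ} {e : Set (Fin n → ℝ)} :
    e ∈ fr.edges v ↔ e ∈ edgesAt P v := by simp [edges]

@[simp] theorem mem_edgesIn {F e : Set (Fin n → ℝ)} {v : Fin n → ℝ} :
    e ∈ fr.edgesIn F v ↔ e ∈ edgesAt P v ∧ e ⊆ F := by simp [edgesIn]

theorem card_faceSet (i : ℕ) : (fr.faceSet i).card = fVector P i := by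
  rw [fVector, Set.ncard_eq_toFinset_card _ (fr.polytope.finite_faces i)]
  rfl

theorem card_edges_eq {v : Fin n → ℝ} (hv : v ∈ vertices P) : (fr.edges v).card = n := by
  have h := fr.card_edges v hv
  rwa [Set.ncard_eq_toFinset_card _ (edgesAt_finite fr.polytope v)] at h

variable {fr} {v : Fin n → ℝ} {e e' F : Set (Fin n → ℝ)}

theorem coord_rdir [DecidableEq (Set (Fin n → ℝ))] (hv : v ∈ vertices P) (he : e ∈ edgesAt P v)
    (he' : e' ∈ edgesAt P v) : fr.coord v e (fr.rdir v e') = if e = e' then 1 else 0 := by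
  split_ifs with h
  · subst h
    exact fr.coord_self v hv e he
  · exact fr.coord_ne v hv e he e' he' h

theorem sum_coord (hv : v ∈ vertices P) (x : Fin n → ℝ) :
    ∑ e ∈ fr.edges v, fr.coord v e x • fr.rdir v e = x := by
  classical
  refine fr.coord_ext v hv _ _ fun e he => ?_
  rw [map_sum, Finset.sum_eq_single e]
  · simp [coord_rdir hv he he]
  · intro e' he' hne
    rw [map_smul, coord_rdir hv he (fr.mem_edges.1 he'), if_neg hne.symm, smul_zero]
  · intro h
    exact absurd (fr.mem_edges.2 he) h

theorem map_eq_sum (hv : v ∈ vertices P) (l : (Fin n → ℝ) →ₗ[ℝ] ℝ) (x : Fin n → ℝ) :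
    l x = ∑ e ∈ fr.edges v, fr.coord v e x * l (fr.rdir v e) := by
  conv_lhs => rw [← sum_coord (fr := fr) hv x, map_sum]
  simp

theorem rdir_ne_zero (hv : v ∈ vertices P) (he : e ∈ edgesAt P v) : fr.rdir v e ≠ 0 := by
  intro h
  have := fr.coord_self v hv e he
  rw [← rdir, h, map_zero] at this
  exact zero_ne_one this

theorem end_mem (hv : v ∈ vertices P) (he : e ∈ edgesAt P v) :
    v + fr.len v e • fr.rdir v e ∈ e := by
  have := right_mem_segment ℝ v (v + fr.len v e • fr.rdir v e)
  rwa [rdir, ← fr.eq_segment v hv e he] at this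

theorem edge_subset (he : e ∈ edgesAt P v) : e ⊆ P := he.1.2.1.subset

/-- A face through `v`, with the data of a functional defining it. -/
theorem exists_functional (hF : IsExposed ℝ P F) (hv : v ∈ vertices P) (hvF : v ∈ F) :
    ∃ l : (Fin n → ℝ) →ₗ[ℝ] ℝ, (∀ e ∈ edgesAt P v, l (fr.rdir v e) ≤ 0) ∧
      (∀ e ∈ edgesAt P v, e ⊆ F ↔ l (fr.rdir v e) = 0) ∧
      ∀ x, x ∈ F ↔ x ∈ P ∧ l (x - v) = 0 := by
  obtain ⟨g, rfl⟩ := hF ⟨v, hvF⟩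
  have hmem : ∀ x, x ∈ {x ∈ P | ∀ y ∈ P, g y ≤ g x} ↔ x ∈ P ∧ g (x - v) = 0 := by
    intro x
    rw [map_sub]
    refine ⟨fun h => ⟨h.1, ?_⟩, fun h => ⟨h.1, fun y hy => ?_⟩⟩
    · linarith [h.2 v hvF.1, hvF.2 x h.1]
    · linarith [hvF.2 y hy]
  refine ⟨g.toLinearMap, fun e he => ?_, fun e he => ?_, hmem⟩
  · have h1 := hvF.2 _ (edge_subset he (end_mem (fr := fr) hv he))
    have h2 := fr.len_pos v hv e he
    simp only [map_add, map_smul, smul_eq_mul] at h1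
    by_contra h3
    have h4 : 0 < g (fr.rdir v e) := not_le.1 h3
    nlinarith [mul_pos h2 h4]
  · have h2 := fr.len_pos v hv e he
    constructor
    · intro h
      have h1 := ((hmem _).1 (h (end_mem (fr := fr) hv he))).2
      rw [add_sub_cancel_left, map_smul, smul_eq_mul] at h1
      exact (mul_eq_zero.1 h1).resolve_left h2.ne'
    · intro h y hy
      refine (hmem y).2 ⟨edge_subset he hy, ?_⟩
      rw [fr.eq_segment v hv e he, segment_eq_image'] at hy
      obtain ⟨t, -, rfl⟩ := hy
      have h' : g (toReal (fr.dir v e)) = 0 := h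
      simp [h']

/-- A functional defining `F` takes on `x - v` a value that is a sum of nonpositive terms, one per
edge. It vanishes only if every term does, so near `v` the face is cut out by the coordinates of the
edges it omits. -/
theorem mem_face_iff (hF : IsExposed ℝ P F) (hv : v ∈ vertices P) (hvF : v ∈ F) {x : Fin n → ℝ} :
    x ∈ F ↔ x ∈ P ∧ ∀ e ∈ edgesAt P v, ¬ e ⊆ F → fr.coord v e (x - v) = 0 := by
  obtain ⟨l, h1, h2, h3⟩ := exists_functional (fr := fr) hF hv hvF
  rw [h3]
  refine and_congr_right fun hx => ?_
  rw [map_eq_sum (fr := fr) hv l, Finset.sum_eq_zero_iff_of_nonpos]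
  · simp only [mem_edges]
    refine forall₂_congr fun e he => ?_
    rw [h2 e he, mul_eq_zero]
    tauto
  · intro e he
    rw [mem_edges] at he
    exact mul_nonpos_of_nonneg_of_nonpos (fr.coord_nonneg v hv e he x hx) (h1 e he)

/-- The defining functional is minus the sum of the coordinates of the edges outside `I`; its
maximum over `P` is attained at `v`. -/
theorem exists_face (fr : Framing P) (hv : v ∈ vertices P) (I : Set (Set (Fin n → ℝ))) :
    ∃ F : Set (Fin n → ℝ), IsExposed ℝ P F ∧ v ∈ F ∧ ∀ e ∈ edgesAt P v, e ⊆ F ↔ e ∈ I := by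
  classical
  set l : (Fin n → ℝ) →ₗ[ℝ] ℝ := -∑ e ∈ (fr.edges v).filter (· ∉ I), fr.coord v e with hl
  have hle : ∀ x ∈ P, l x ≤ l v := by
    intro x hx
    have : l (x - v) ≤ 0 := by
      simp only [hl, LinearMap.neg_apply, LinearMap.sum_apply, Left.neg_nonpos_iff]
      refine Finset.sum_nonneg fun e he => ?_
      simp only [Finset.mem_filter, mem_edges] at he
      exact fr.coord_nonneg v hv e he.1 x hx
    rw [map_sub] at this
    linarith
  have hvP : v ∈ P := (fr.polytope.mem_vertices_iff.1 hv).1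
  set F : Set (Fin n → ℝ) := {x ∈ P | ∀ y ∈ P, l y ≤ l x} with hFdef
  have hF : IsExposed ℝ P F := fun _ => ⟨LinearMap.toContinuousLinearMap l, rfl⟩
  have hmem : ∀ x, x ∈ F ↔ x ∈ P ∧ l (x - v) = 0 := by
    intro x
    rw [map_sub]
    refine ⟨fun h => ⟨h.1, ?_⟩, fun h => ⟨h.1, fun y hy => ?_⟩⟩
    · linarith [h.2 v hvP, hle x h.1]
    · linarith [hle y hy]
  have hldir : ∀ e ∈ edgesAt P v, l (fr.rdir v e) = if e ∈ I then 0 else -1 := by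
    intro e he
    have : ∀ e' ∈ (fr.edges v).filter (· ∉ I), fr.coord v e' (fr.rdir v e) =
        if e = e' then 1 else 0 := by
      intro e' he'
      simp only [Finset.mem_filter, mem_edges] at he'
      rw [coord_rdir hv he'.1 he]
      simp [eq_comm]
    rw [hl, LinearMap.neg_apply, LinearMap.sum_apply, Finset.sum_congr rfl this, Finset.sum_ite_eq]
    by_cases h : e ∈ I <;> simp [h, he]
  refine ⟨F, hF, ⟨hvP, hle⟩, fun e he => ?_⟩
  have hpos := fr.len_pos v hv e he
  constructor
  · intro h
    have h1 := ((hmem _).1 (h (end_mem (fr := fr) hv he))).2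
    rw [add_sub_cancel_left, map_smul, smul_eq_mul, hldir e he] at h1
    by_contra h2
    rw [if_neg h2] at h1
    linarith
  · intro h y hy
    refine (hmem y).2 ⟨edge_subset he hy, ?_⟩
    rw [fr.eq_segment v hv e he, segment_eq_image'] at hy
    obtain ⟨t, -, rfl⟩ := hy
    have h' : l (toReal (fr.dir v e)) = 0 := by
      have := hldir e he
      rwa [if_pos h] at this
    simp [h']

theorem linearIndepOn_rdir (hv : v ∈ vertices P) :
    LinearIndepOn ℝ (fr.rdir v) (edgesAt P v) := by
  classical
  rw [linearIndepOn_iff']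
  intro s g hs h e he
  have h1 := congrArg (fr.coord v e) h
  rw [map_sum, map_zero, Finset.sum_eq_single e] at h1
  · simpa [coord_rdir hv (hs he) (hs he)] using h1
  · intro e' he' hne
    rw [map_smul, coord_rdir hv (hs he) (hs he'), if_neg hne.symm, smul_zero]
  · exact fun h => absurd he h

theorem vectorSpan_face (hF : IsExposed ℝ P F) (hv : v ∈ vertices P) (hvF : v ∈ F) :
    vectorSpan ℝ F = Submodule.span ℝ (fr.rdir v '' (fr.edgesIn F v : Set (Set (Fin n → ℝ)))) := by
  rw [vectorSpan_eq_span_vsub_set_right ℝ hvF]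
  apply le_antisymm
  · rw [Submodule.span_le]
    rintro _ ⟨y, hy, rfl⟩
    simp only [vsub_eq_sub, SetLike.mem_coe]
    rw [← sum_coord (fr := fr) hv (y - v)]
    refine Submodule.sum_mem _ fun e he => ?_
    by_cases h : e ⊆ F
    · exact Submodule.smul_mem _ _ (Submodule.subset_span
        ⟨e, by simpa [h] using he, rfl⟩)
    · rw [((mem_face_iff hF hv hvF).1 hy).2 e (fr.mem_edges.1 he) h, zero_smul]
      exact Submodule.zero_mem _
  · rw [Submodule.span_le]
    rintro _ ⟨e, he, rfl⟩
    simp only [Finset.mem_coe, mem_edgesIn] at he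
    have h1 : (v + fr.len v e • fr.rdir v e) - v ∈ Submodule.span ℝ ((fun y => y -ᵥ v) '' F) :=
      Submodule.subset_span ⟨_, he.2 (end_mem hv he.1), rfl⟩
    rw [add_sub_cancel_left] at h1
    have h2 := Submodule.smul_mem _ (fr.len v e)⁻¹ h1
    rwa [inv_smul_smul₀ (fr.len_pos v hv e he.1).ne'] at h2

/-- The directions of these edges are independent and span the direction space of `F`. -/
theorem card_edgesIn (hF : IsExposed ℝ P F) (hv : v ∈ vertices P) (hvF : v ∈ F) :
    (fr.edgesIn F v).card = dim F := by
  classical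
  have hind : LinearIndepOn ℝ (fr.rdir v) (fr.edgesIn F v : Set (Set (Fin n → ℝ))) :=
    (linearIndepOn_rdir hv).mono fun e he => (fr.mem_edgesIn.1 he).1
  rw [dim, vectorSpan_face (fr := fr) hF hv hvF, Set.image_eq_range,
    finrank_span_eq_card (b := fun i : (fr.edgesIn F v : Set (Set (Fin n → ℝ))) => fr.rdir v i) hind]
  simp

/-- A face is determined by a vertex on it and the edges at that vertex which it contains. -/
theorem face_ext {G : Set (Fin n → ℝ)} (hF : IsExposed ℝ P F) (hG : IsExposed ℝ P G)
    (hv : v ∈ vertices P) (hvF : v ∈ F) (hvG : v ∈ G) (h : fr.edgesIn F v = fr.edgesIn G v) :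
    F = G := by
  have h' : ∀ e ∈ edgesAt P v, e ⊆ F ↔ e ⊆ G := by
    intro e he
    have := congrArg (e ∈ ·) h
    simpa [he] using this
  ext x
  rw [mem_face_iff (fr := fr) hF hv hvF, mem_face_iff (fr := fr) hG hv hvG]
  refine and_congr_right fun _ => forall₂_congr fun e he => ?_
  rw [h' e he]

/-- For a set `I` of edges at `v` there is a unique face through `v` whose edges at `v` are those
in `I`. -/
theorem exists_face_of_subset (hv : v ∈ vertices P) {I : Finset (Set (Fin n → ℝ))}
    (hI : I ⊆ fr.edges v) :
    ∃ F ∈ faces P I.card, v ∈ F ∧ fr.edgesIn F v = I := by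
  obtain ⟨F, hF, hvF, h⟩ := exists_face fr hv (I : Set (Set (Fin n → ℝ)))
  have hE : fr.edgesIn F v = I := by
    ext e
    rw [mem_edgesIn]
    constructor
    · rintro ⟨h1, h2⟩
      exact (h e h1).1 h2
    · intro h1
      have := fr.mem_edges.1 (hI h1)
      exact ⟨this, (h e this).2 h1⟩
  refine ⟨F, ⟨⟨v, hvF⟩, hF, ?_⟩, hvF, hE⟩
  rw [← card_edgesIn (fr := fr) hF hv hvF, hE]

/-! ### Minimal vertices -/

/-- The minimizers form an exposed subface of the compact face; it has an extreme point by
Krein–Milman, and this point is extreme in `P`. -/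
theorem exists_vertex_min (hP : IsPolytope P) (hF : IsExposed ℝ P F) (hne : F.Nonempty)
    (l : (Fin n → ℝ) →ₗ[ℝ] ℝ) : ∃ v ∈ vertices P, v ∈ F ∧ ∀ x ∈ F, l v ≤ l x := by
  have hcomp := hF.isCompact hP.isCompact
  have hl : Continuous l := LinearMap.continuous_of_finiteDimensional l
  set G : Set (Fin n → ℝ) := {x ∈ F | ∀ y ∈ F, (-l) y ≤ (-l) x} with hG
  have hGF : IsExposed ℝ F G := fun _ => ⟨LinearMap.toContinuousLinearMap (-l), rfl⟩
  have hGne : G.Nonempty := by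
    obtain ⟨x, hx, hmin⟩ := hcomp.exists_isMinOn hne hl.continuousOn
    exact ⟨x, hx, fun y hy => by simpa using hmin hy⟩
  obtain ⟨v, hv⟩ := (hGF.isCompact hcomp).extremePoints_nonempty hGne
  have h1 := hGF.isExtreme.extremePoints_subset_extremePoints hv
  have h2 := hF.isExtreme.extremePoints_subset_extremePoints h1
  exact ⟨v, hP.mem_vertices_iff.2 h2, h1.1, fun x hx => by simpa using hv.1.2 x hx⟩

/-- On a face, a functional not vanishing on the edges increases along all edges from exactly one
vertex. -/
theorem exists_unique_vertex_min (hF : IsExposed ℝ P F) (hne : F.Nonempty)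
    (l : (Fin n → ℝ) →ₗ[ℝ] ℝ)
    (hl : ∀ v ∈ vertices P, v ∈ F → ∀ e ∈ fr.edgesIn F v, l (fr.rdir v e) ≠ 0) :
    ∃! v, v ∈ vertices P ∧ v ∈ F ∧ ∀ e ∈ fr.edgesIn F v, 0 < l (fr.rdir v e) := by
  -- A vertex from which `l` increases along all edges of `F` is its strict global minimum on `F`,
  -- because `x - v` is a nonnegative combination of those edges.
  have key : ∀ v ∈ vertices P, v ∈ F → (∀ e ∈ fr.edgesIn F v, 0 < l (fr.rdir v e)) →
      ∀ x ∈ F, l x ≤ l v → x = v := by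
    intro v hv hvF hpos x hx hle
    have hx' := (mem_face_iff (fr := fr) hF hv hvF).1 hx
    have h0 : l (x - v) ≤ 0 := by rw [map_sub]; linarith
    rw [map_eq_sum (fr := fr) hv l] at h0
    have hnn : ∀ e ∈ fr.edges v, 0 ≤ fr.coord v e (x - v) * l (fr.rdir v e) := by
      intro e he
      rw [mem_edges] at he
      by_cases h : e ⊆ F
      · exact mul_nonneg (fr.coord_nonneg v hv e he x hx'.1)
          (hpos e (fr.mem_edgesIn.2 ⟨he, h⟩)).le
      · rw [hx'.2 e he h, zero_mul]
    have h1 := (Finset.sum_eq_zero_iff_of_nonneg hnn).1 (le_antisymm h0 (Finset.sum_nonneg hnn))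
    refine sub_eq_zero.1 (fr.coord_ext v hv _ _ fun e he => ?_)
    rw [map_zero]
    by_cases h : e ⊆ F
    · exact (mul_eq_zero.1 (h1 e (fr.mem_edges.2 he))).resolve_right
        (hpos e (fr.mem_edgesIn.2 ⟨he, h⟩)).ne'
    · exact hx'.2 e he h
  obtain ⟨v, hv, hvF, hmin⟩ := exists_vertex_min fr.polytope hF hne l
  have hpos : ∀ e ∈ fr.edgesIn F v, 0 < l (fr.rdir v e) := by
    intro e he
    refine lt_of_le_of_ne ?_ (hl v hv hvF e he).symm
    have he' := fr.mem_edgesIn.1 he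
    have h1 := hmin _ (he'.2 (end_mem (fr := fr) hv he'.1))
    rw [map_add, map_smul, smul_eq_mul] at h1
    have := fr.len_pos v hv e he'.1
    by_contra h2
    nlinarith [mul_pos_of_neg_of_neg (not_le.1 h2) (neg_neg_of_pos this)]
  refine ⟨v, ⟨hv, hvF, hpos⟩, ?_⟩
  rintro u ⟨hu, huF, hpos'⟩
  exact (key u hu huF hpos' v hvF (hmin u huF)).symm

/-! ### Edges -/


theorem isPrimitive_dir (hv : v ∈ vertices P) (he : e ∈ edgesAt P v) :
    IsPrimitive (fr.dir v e) := by
  intro m u h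
  have h1 := fr.coord_self v hv e he
  obtain ⟨k, hk⟩ := fr.coord_int v e u
  rw [h, toReal_smul, map_smul, hk, smul_eq_mul] at h1
  have h2 : m * k = 1 := by exact_mod_cast h1
  exact Int.eq_one_or_neg_one_of_mul_eq_one h2

theorem isRelativeLength_len (hv : v ∈ vertices P) (he : e ∈ edgesAt P v) :
    IsRelativeLength e (fr.len v e) :=
  ⟨v, v + fr.len v e • fr.rdir v e, fr.dir v e, fr.eq_segment v hv e he, isPrimitive_dir hv he,
    fr.len_pos v hv e he, by rw [add_sub_cancel_left]; rfl⟩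

/-- The other end of an edge. -/
def opp (fr : Framing P) (v : Fin n → ℝ) (e : Set (Fin n → ℝ)) : Fin n → ℝ :=
  v + fr.len v e • fr.rdir v e

theorem eq_segment_opp (hv : v ∈ vertices P) (he : e ∈ edgesAt P v) :
    e = segment ℝ v (fr.opp v e) := fr.eq_segment v hv e he

theorem opp_ne (hv : v ∈ vertices P) (he : e ∈ edgesAt P v) : fr.opp v e ≠ v := by
  intro h
  rw [opp, add_eq_left, smul_eq_zero] at h
  rcases h with h | h
  · exact (fr.len_pos v hv e he).ne' h
  · exact rdir_ne_zero hv he h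

theorem right_mem_extremePoints_segment {E : Type*} [AddCommGroup E] [Module ℝ E] (x d : E) :
    x + d ∈ (segment ℝ x (x + d)).extremePoints ℝ := by
  rcases eq_or_ne d 0 with rfl | hd
  · simp
  rw [mem_extremePoints]
  refine ⟨right_mem_segment ℝ _ _, ?_⟩
  rintro a ha b hb ⟨s, t, hs, ht, hst, h⟩
  rw [segment_eq_image'] at ha hb
  obtain ⟨p, hp, rfl⟩ := ha
  obtain ⟨q, hq, rfl⟩ := hb
  simp only [add_sub_cancel_left] at h ⊢
  have h1 : (s * p + t * q - 1) • d = 0 := by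
    have hx : (s + t) • x = x := by rw [hst, one_smul]
    rw [add_smul] at hx
    rw [smul_add, smul_add, smul_smul, smul_smul] at h
    rw [sub_smul, add_smul, one_smul]
    have h2 : s • x + (s * p) • d + (t • x + (t * q) • d) =
      (s • x + t • x) + ((s * p) • d + (t * q) • d) := by abel
    rw [h2, hx] at h
    rw [add_left_cancel h, sub_self]
  have h2 := (smul_eq_zero.1 h1).resolve_right hd
  have hp1 : p = 1 := by nlinarith [hp.2, hq.2, mul_nonneg ht.le (sub_nonneg.2 hq.2)]
  have hq1 : q = 1 := by nlinarith [hp.2, hq.2, mul_nonneg hs.le (sub_nonneg.2 hp.2)]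
  simp [hp1, hq1]

theorem opp_mem_vertices (hv : v ∈ vertices P) (he : e ∈ edgesAt P v) :
    fr.opp v e ∈ vertices P := by
  rw [fr.polytope.mem_vertices_iff]
  refine he.1.2.1.isExtreme.extremePoints_subset_extremePoints ?_
  conv_lhs => rw [eq_segment_opp (fr := fr) hv he]
  exact right_mem_extremePoints_segment _ _

theorem mem_edgesAt_opp (hv : v ∈ vertices P) (he : e ∈ edgesAt P v) :
    e ∈ edgesAt P (fr.opp v e) := ⟨he.1, end_mem hv he⟩

theorem exists_vertex_of_edge (hP : IsPolytope P) (he : e ∈ faces P 1) :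
    ∃ v ∈ vertices P, e ∈ edgesAt P v := by
  obtain ⟨v, hv, hve, -⟩ := exists_vertex_min hP he.2.1 he.1 0
  exact ⟨v, hv, he, hve⟩

/-- The vertices on an edge are its two ends. -/
theorem vertex_mem_edge_iff (hv : v ∈ vertices P) (he : e ∈ edgesAt P v) {u : Fin n → ℝ}
    (hu : u ∈ vertices P) : u ∈ e ↔ u = v ∨ u = fr.opp v e := by
  constructor
  · intro hue
    have h1 := fr.polytope.mem_vertices_iff.1 hu
    rw [mem_extremePoints_iff_left] at h1
    have hvP := (fr.polytope.mem_vertices_iff.1 hv).1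
    have hoP := (fr.polytope.mem_vertices_iff.1 (opp_mem_vertices (fr := fr) hv he)).1
    rw [eq_segment_opp (fr := fr) hv he] at hue
    rcases eq_or_ne u v with h | h
    · exact Or.inl h
    rcases eq_or_ne u (fr.opp v e) with h' | h'
    · exact Or.inr h'
    exact absurd (h1.2 v hvP _ hoP (mem_openSegment_of_ne_left_right h.symm h'.symm hue)) h.symm
  · rintro (rfl | rfl)
    · exact he.2
    · exact end_mem hv he

/-- Uniqueness of relative length makes the lengths seen from the two ends agree; going along the
edge and back then forces opposite directions. -/
theorem rdir_opp_and_len (hv : v ∈ vertices P) (he : e ∈ edgesAt P v) :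
    fr.opp (fr.opp v e) e = v ∧ fr.len (fr.opp v e) e = fr.len v e ∧
      fr.rdir (fr.opp v e) e = -fr.rdir v e := by
  have hv' := opp_mem_vertices (fr := fr) hv he
  have he' := mem_edgesAt_opp (fr := fr) hv he
  have h1 : fr.opp (fr.opp v e) e = v := by
    have := (vertex_mem_edge_iff (fr := fr) hv' he' hv).1 he.2
    exact (this.resolve_left (opp_ne hv he).symm).symm
  have h2 : fr.len (fr.opp v e) e = fr.len v e :=
    (isRelativeLength_len hv' he').unique (isRelativeLength_len hv he)
  refine ⟨h1, h2, ?_⟩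
  have h3 : fr.len v e • (fr.rdir v e + fr.rdir (fr.opp v e) e) = 0 := by
    have h4 : fr.opp v e + fr.len (fr.opp v e) e • fr.rdir (fr.opp v e) e = v := h1
    rw [h2] at h4
    have h5 : v + (fr.len v e • fr.rdir v e + fr.len v e • fr.rdir (fr.opp v e) e) = v := by
      rw [← add_assoc]
      exact h4
    rw [smul_add]
    simpa using h5
  have h6 := (smul_eq_zero.1 h3).resolve_left (fr.len_pos v hv e he).ne'
  exact (neg_eq_of_add_eq_zero_right h6).symm

theorem relativeLength_eq_len (hv : v ∈ vertices P) (he : e ∈ edgesAt P v) :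
    relativeLength e = fr.len v e := (isRelativeLength_len hv he).relativeLength_eq

end Framing

end DelzantReflexive

end

/-! ### Dedekind sums and a potential on primitive vectors of the plane. -/

noncomputable section

namespace DelzantReflexive

/-! ### A Dedekind-type function on primitive vectors of the plane -/

/-- The right-hand side of the reciprocity law. -/
def recipTerm (h k : ℝ) : ℝ := h / k + k / h + 1 / (h * k) - 3

/-- Twelve times the Dedekind sum `s(h, k)`, computed by the Euclidean algorithm. -/
def dedekind (h k : ℕ) : ℝ :=
  if _h : k = 0 ∨ h % k = 0 then 0 else recipTerm (h % k : ℕ) k - dedekind k (h % k)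
termination_by k
decreasing_by
  push Not at _h
  exact Nat.mod_lt _ (Nat.pos_of_ne_zero _h.1)

theorem dedekind_mod (h k : ℕ) : dedekind (h % k) k = dedekind h k := by
  rw [dedekind, dedekind.eq_1 h k, Nat.mod_mod]

theorem dedekind_congr {h h' k : ℕ} (H : h ≡ h' [MOD k]) : dedekind h k = dedekind h' k := by
  rw [← dedekind_mod h, ← dedekind_mod h', H]

theorem recipTerm_comm (h k : ℝ) : recipTerm h k = recipTerm k h := by
  unfold recipTerm
  rw [mul_comm h k]
  ring

/-- For `h < k` this is one step of the Euclidean recursion that defines `dedekind`. Coprimality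
matters only for `h = k`, where it leaves `h = k = 1`. -/
theorem dedekind_reciprocity {h k : ℕ} (hh : 0 < h) (hk : 0 < k) (hc : Nat.Coprime h k) :
    dedekind h k + dedekind k h = recipTerm h k := by
  have key : ∀ {h k : ℕ}, 0 < h → h < k → dedekind h k + dedekind k h = recipTerm h k := by
    intro h k hh hk
    rw [dedekind, dif_neg, Nat.mod_eq_of_lt hk, sub_add_cancel]
    rw [Nat.mod_eq_of_lt hk]
    omega
  rcases lt_trichotomy h k with hlt | rfl | hlt
  · exact key hh hlt
  · rw [Nat.coprime_self] at hc
    subst hc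
    rw [dedekind]
    norm_num [recipTerm]
  · rw [add_comm, key hk hlt, recipTerm_comm]

/-- Oddness follows from reciprocity for the pairs `(k-h, k)`, `(h, k-h)` and `(h, k)`. With `k ≡ h`
modulo `k-h` and `k ≡ k-h` modulo `h`, the alternating sum of the three laws leaves the two wanted
terms, and the right-hand sides cancel. -/
theorem dedekind_sub {h k : ℕ} (hh : 0 < h) (hk : h < k) (hc : Nat.Coprime h k) :
    dedekind (k - h) k = -dedekind h k := by
  obtain ⟨m, rfl⟩ := Nat.exists_eq_add_of_lt hk
  have e1 : h + m + 1 - h = m + 1 := by omega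
  rw [e1]
  have hc1 : Nat.Coprime (m + 1) (h + m + 1) := by
    rw [Nat.coprime_comm] at hc
    have : h + m + 1 = (m + 1) + h := by ring
    rw [this] at hc ⊢
    simp only [Nat.coprime_add_self_left, Nat.coprime_self_add_right] at hc ⊢
    exact hc
  have hc2 : Nat.Coprime h (m + 1) := by
    have : h + m + 1 = (m + 1) + h := by ring
    rw [this] at hc
    simpa using hc
  have r1 := dedekind_reciprocity (Nat.succ_pos m) (by omega : 0 < h + m + 1) hc1
  have r2 := dedekind_reciprocity hh (Nat.succ_pos m) hc2
  have r3 := dedekind_reciprocity hh (by omega : 0 < h + m + 1) hc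
  have c1 : dedekind (h + m + 1) (m + 1) = dedekind h (m + 1) :=
    dedekind_congr (by rw [add_assoc]; simp [Nat.ModEq])
  have c2 : dedekind (h + m + 1) h = dedekind (m + 1) h :=
    dedekind_congr (by rw [add_assoc]; simp [Nat.ModEq])
  have hh' : (h : ℝ) ≠ 0 := by positivity
  have hm' : (m : ℝ) + 1 ≠ 0 := by positivity
  have hs' : (h : ℝ) + m + 1 ≠ 0 := by positivity
  have hR : recipTerm (m + 1 : ℕ) (h + m + 1 : ℕ) - recipTerm h (m + 1 : ℕ) +
      recipTerm h (h + m + 1 : ℕ) = 0 := by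
    unfold recipTerm
    push_cast
    field_simp
    ring
  rw [Nat.succ_eq_add_one] at *
  rw [c1] at r1
  rw [c2] at r3
  linarith

/-- `dedekind` with an integral first argument. -/
def dedekindInt (h : ℤ) (k : ℕ) : ℝ := dedekind (h % k).toNat k

theorem dedekindInt_congr {h h' : ℤ} {k : ℕ} (H : (k : ℤ) ∣ h - h') :
    dedekindInt h k = dedekindInt h' k := by
  rw [dedekindInt, dedekindInt, show h % (k : ℤ) = h' % k from (Int.modEq_iff_dvd.2 H).symm]

theorem dedekindInt_natCast (h k : ℕ) : dedekindInt h k = dedekind h k := by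
  rw [dedekindInt, ← Int.natCast_mod, Int.toNat_natCast, dedekind_mod]

theorem dedekindInt_neg_natCast {h k : ℕ} (hk : 0 < k) (hc : Nat.Coprime h k) :
    dedekindInt (-h) k = -dedekind h k := by
  rcases Nat.eq_zero_or_pos (h % k) with h0 | h0
  · have hk1 : k = 1 := by
      have := Nat.dvd_of_mod_eq_zero h0
      rwa [Nat.coprime_comm, Nat.Coprime, Nat.gcd_eq_left this] at hc
    subst hk1
    have h1 : ∀ j, dedekind j 1 = 0 := fun j => by
      rw [dedekind]
      simp [Nat.mod_one]
    rw [dedekindInt, h1, h1, neg_zero]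
  · have hlt := Nat.mod_lt h hk
    have hc' : Nat.Coprime (h % k) k := by
      rw [Nat.Coprime, ← Nat.gcd_rec, Nat.gcd_comm]
      exact hc
    rw [← dedekind_mod h, ← dedekind_sub h0 hlt hc', ← dedekindInt_natCast]
    refine dedekindInt_congr ?_
    rw [Nat.cast_sub hlt.le]
    have h1 : (h : ℤ) = k * (h / k : ℕ) + (h % k : ℕ) := by exact_mod_cast (Nat.div_add_mod h k).symm
    refine ⟨-(h / k : ℕ) - 1, ?_⟩
    linarith

/-- There is a function on vectors of `ℤ²` whose difference at a positively oriented lattice basis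
is the function `a / b + b / a` of the second coordinates `a`, `b`, up to a sign correction. -/
theorem exists_planar_potential : ∃ G : ℤ → ℤ → ℝ, (∀ p q, G (-p) (-q) = G p q) ∧
    ∀ p q p' q' : ℤ, p * q' - p' * q = 1 → q ≠ 0 → q' ≠ 0 →
      G p q - G p' q' = (q : ℝ) / q' + q' / q + 3 - if 0 < q * q' then 6 else 0 := by
  -- A Rademacher-type function: the Bézout coefficient is an inverse of `p` modulo `q`, and `-p/q`
  -- will absorb the term `1/(hk)` of reciprocity.
  let H : ℤ → ℤ → ℝ := fun p q => dedekindInt (Int.gcdA p q) q.toNat - p / q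
  have hH : ∀ p x q y : ℤ, 0 < q → p * x + q * y = 1 →
      H p q = dedekindInt x q.toNat - p / q := by
    intro p x q y hq h
    have hg : Int.gcd p q = 1 := Int.isCoprime_iff_gcd_eq_one.1 ⟨x, y, by linarith⟩
    have h1 := Int.gcd_eq_gcd_ab p q
    rw [hg] at h1
    simp only [H]
    congr 1
    refine dedekindInt_congr ?_
    rw [Int.toNat_of_nonneg hq.le]
    have hcop : IsCoprime q p := ⟨y, x, by linarith⟩
    refine hcop.dvd_of_dvd_mul_left ⟨y - Int.gcdB p q, ?_⟩
    push_cast at h1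
    linear_combination -h1 - h
  have key : ∀ p q p' q' : ℤ, p * q' - p' * q = 1 → 0 < q → 0 < q' →
      H p q - H p' q' = (q : ℝ) / q' + q' / q - 3 := by
    intro p q p' q' h hq hq'
    -- The determinant equation makes `q'` an inverse of `p` modulo `q`, and `-q` an inverse of `p'`
    -- modulo `q'`. Oddness then turns the difference into the sum in the reciprocity law.
    rw [hH p q' q (-p') hq (by linarith), hH p' (-q) q' p hq' (by linarith)]
    lift q to ℕ using hq.le
    lift q' to ℕ using hq'.le
    have hq0 : 0 < q := by exact_mod_cast hq
    have hq0' : 0 < q' := by exact_mod_cast hq'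
    have hc : Nat.Coprime q q' :=
      Nat.isCoprime_iff_coprime.1 ⟨-p', p, by linarith⟩
    rw [Int.toNat_natCast, Int.toNat_natCast, dedekindInt_natCast,
      dedekindInt_neg_natCast hq0' hc]
    have hr := dedekind_reciprocity hq0 hq0' hc
    have hR : (p : ℝ) * q' - p' * q = 1 := by exact_mod_cast h
    have h1 : (q : ℝ) ≠ 0 := by positivity
    have h2 : (q' : ℝ) ≠ 0 := by positivity
    have h3 : 1 / ((q : ℝ) * q') = p / q - p' / q' := by
      field_simp
      linarith
    rw [recipTerm, h3] at hr
    push_cast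
    linarith
  -- Even extension of `H` to both half-planes; the value at `q = 0` is arbitrary apart from
  -- evenness.
  let G : ℤ → ℤ → ℝ := fun p q => if 0 < q then H p q else if q < 0 then H (-p) (-q) else 0
  have hpos : ∀ p q, 0 < q → G p q = H p q := fun p q h => if_pos h
  have hneg : ∀ p q, q < 0 → G p q = H (-p) (-q) := fun p q h => by
    simp only [G, if_neg h.not_gt, if_pos h]
  refine ⟨G, ?_, ?_⟩
  · intro p q
    rcases lt_trichotomy q 0 with h | rfl | h
    · rw [hpos _ _ (neg_pos.2 h), hneg _ _ h]
    · simp [G]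
    · rw [hneg _ _ (neg_neg_of_pos h), hpos _ _ h, neg_neg, neg_neg]
  · intro p q p' q' h hq hq'
    have hqr : (q : ℝ) ≠ 0 := by exact_mod_cast hq
    have hqr' : (q' : ℝ) ≠ 0 := by exact_mod_cast hq'
    rcases lt_or_gt_of_ne hq with h1 | h1 <;> rcases lt_or_gt_of_ne hq' with h2 | h2
    · rw [hneg _ _ h1, hneg _ _ h2, if_pos (mul_pos_of_neg_of_neg h1 h2),
        key _ _ _ _ (by linarith) (by omega) (by omega)]
      push_cast
      rw [neg_div_neg_eq, neg_div_neg_eq]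
      ring
    -- For opposite signs, negating one vector reverses the orientation of the basis, so the formula
    -- is used with the two vectors exchanged. This changes `-3` into `+3` and accounts for the
    -- correction term.
    · rw [hneg _ _ h1, hpos _ _ h2, if_neg (by nlinarith)]
      have := key p' q' (-p) (-q) (by linarith) h2 (by omega)
      push_cast at this
      rw [div_neg, neg_div] at this
      linarith
    · rw [hpos _ _ h1, hneg _ _ h2, if_neg (by nlinarith)]
      have := key (-p') (-q') p q (by linarith) (by omega) h1
      push_cast at this
      rw [div_neg, neg_div] at this
      linarith
    · rw [hpos _ _ h1, hpos _ _ h2, if_pos (mul_pos h1 h2), key _ _ _ _ h h1 h2]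
      ring

end DelzantReflexive

end

/-! ### Smooth polygons: the sum over the edges of a two-dimensional face. -/

noncomputable section

namespace DelzantReflexive

namespace Framing

variable {n : ℕ} {P : Set (Fin n → ℝ)} {fr : Framing P} {v u : Fin n → ℝ}
  {e f F Q : Set (Fin n → ℝ)}

/-! ### Flags -/

open Classical in
theorem sum_vertices_edge {M : Type*} [AddCommMonoid M] (hv : v ∈ vertices P)
    (he : e ∈ edgesAt P v) (g : (Fin n → ℝ) → M) :
    ∑ u ∈ fr.verts with u ∈ e, g u = g v + g (fr.opp v e) := by
  have : (fr.verts.filter (· ∈ e)) = {v, fr.opp v e} := by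
    ext u
    simp only [Finset.mem_filter, mem_verts, Finset.mem_insert, Finset.mem_singleton]
    constructor
    · rintro ⟨hu, hue⟩
      exact (vertex_mem_edge_iff hv he hu).1 hue
    · rintro (rfl | rfl)
      · exact ⟨hv, he.2⟩
      · exact ⟨opp_mem_vertices hv he, end_mem hv he⟩
  rw [this, Finset.sum_pair (opp_ne hv he).symm]

open Classical in
theorem sum_flags {M : Type*} [AddCommMonoid M] (fr : Framing P) (F : Set (Fin n → ℝ))
    (g : (Fin n → ℝ) → Set (Fin n → ℝ) → M) :
    ∑ v ∈ fr.verts with v ∈ F, ∑ e ∈ fr.edgesIn F v, g v e =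
      ∑ e ∈ fr.faceSet 1 with e ⊆ F, ∑ v ∈ fr.verts with v ∈ e, g v e := by
  refine Finset.sum_comm' fun v e => ?_
  simp only [Finset.mem_filter, mem_verts, mem_edgesIn, mem_faceSet, edgesAt, Set.mem_ofPred_eq]
  constructor
  · rintro ⟨⟨h1, -⟩, ⟨h2, h3⟩, h4⟩
    exact ⟨⟨h1, h3⟩, h2, h4⟩
  · rintro ⟨⟨h1, h2⟩, h3, h4⟩
    exact ⟨⟨h1, h4 h2⟩, ⟨h3, h2⟩, h4⟩

/-- Both ends of `f` lie in `F`, so the coordinates at `v` transverse to `F` vanish on its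
direction. -/
theorem rdir_eq_sum (hF : IsExposed ℝ P F) (hv : v ∈ vertices P) (hvF : v ∈ F)
    (hu : u ∈ vertices P) (huF : u ∈ F) (hf : f ∈ fr.edgesIn F u) :
    fr.rdir u f = ∑ e ∈ fr.edgesIn F v, fr.coord v e (fr.rdir u f) • fr.rdir v e := by
  classical
  have hf' := fr.mem_edgesIn.1 hf
  conv_lhs => rw [← sum_coord (fr := fr) hv (fr.rdir u f)]
  refine (Finset.sum_subset (Finset.filter_subset _ _) fun e he he' => ?_).symm
  rw [mem_edges] at he
  have h : ¬ e ⊆ F := fun h => he' (fr.mem_edgesIn.2 ⟨he, h⟩)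
  have h1 := ((mem_face_iff (fr := fr) hF hv hvF).1 huF).2 e he h
  have h2 := ((mem_face_iff (fr := fr) hF hv hvF).1 (hf'.2 (end_mem (fr := fr) hu hf'.1))).2 e he h
  rw [add_sub_right_comm, map_add, h1, zero_add, map_smul, smul_eq_mul] at h2
  rw [(mul_eq_zero.1 h2).resolve_left (fr.len_pos u hu f hf'.1).ne', zero_smul]

theorem exists_edgesIn_eq_pair (hQ : Q ∈ faces P 2) (hv : v ∈ vertices P) (hvQ : v ∈ Q)
    (he : e ∈ fr.edgesIn Q v) [DecidableEq (Set (Fin n → ℝ))] :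
    ∃ f, e ≠ f ∧ fr.edgesIn Q v = {e, f} := by
  have hcard : (fr.edgesIn Q v).card = 2 := by
    rw [card_edgesIn hQ.2.1 hv hvQ, hQ.2.2]
  obtain ⟨a, b, hab, h⟩ := Finset.card_eq_two.1 hcard
  rw [h, Finset.mem_insert, Finset.mem_singleton] at he
  rcases he with rfl | rfl
  · exact ⟨b, hab, h⟩
  · exact ⟨a, hab.symm, by rw [h, Finset.pair_comm]⟩

theorem opp_mem (hv : v ∈ vertices P) (he : e ∈ fr.edgesIn F v) :
    fr.opp v e ∈ F ∧ e ∈ fr.edgesIn F (fr.opp v e) := by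
  have he' := fr.mem_edgesIn.1 he
  exact ⟨he'.2 (end_mem hv he'.1), fr.mem_edgesIn.2 ⟨mem_edgesAt_opp hv he'.1, he'.2⟩⟩

/-- Transport of a neighbouring edge in a two-dimensional face along an edge. -/
theorem exists_sub_eq_smul (hQ : Q ∈ faces P 2) (hv : v ∈ vertices P) (hvQ : v ∈ Q)
    {e' e'' : Set (Fin n → ℝ)} (he : e ∈ fr.edgesIn Q v) (he' : e' ∈ fr.edgesIn Q v) (hne : e' ≠ e)
    (he'' : e'' ∈ fr.edgesIn Q (fr.opp v e)) (hne' : e'' ≠ e) :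
    ∃ b : ℝ, fr.rdir v e' - fr.rdir (fr.opp v e) e'' = b • fr.rdir v e := by
  classical
  have hev := (fr.mem_edgesIn.1 he).1
  have hev' := (fr.mem_edgesIn.1 he').1
  set u := fr.opp v e with hu
  obtain ⟨huQ, heu⟩ := opp_mem hv he
  have huP : u ∈ vertices P := opp_mem_vertices hv hev
  have heu' := (fr.mem_edgesIn.1 heu).1
  have heu'' := (fr.mem_edgesIn.1 he'').1
  obtain ⟨-, -, hneg⟩ := rdir_opp_and_len (fr := fr) hv hev
  have hpair : fr.edgesIn Q v = {e, e'} := by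
    obtain ⟨f, hf, hE⟩ := exists_edgesIn_eq_pair hQ hv hvQ he
    rw [hE, Finset.mem_insert, Finset.mem_singleton] at he'
    rw [hE, he'.resolve_left hne]
  have hpair' : fr.edgesIn Q u = {e, e''} := by
    obtain ⟨f, hf, hE⟩ := exists_edgesIn_eq_pair hQ huP huQ heu
    rw [hE, Finset.mem_insert, Finset.mem_singleton] at he''
    rw [hE, he''.resolve_left hne']
  have h1 := rdir_eq_sum hQ.2.1 hv hvQ huP huQ he''
  have h2 := rdir_eq_sum hQ.2.1 huP huQ hv hvQ he'
  rw [hpair, Finset.sum_pair hne.symm] at h1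
  rw [hpair', Finset.sum_pair hne'.symm] at h2
  -- The far end of `e''` lies in `P`, and `e` has no component along `e'`. This sign selects `1`
  -- among the two integer units allowed by the next identity.
  have hα : 0 ≤ fr.coord v e' (fr.rdir u e'') := by
    have h3 := fr.coord_nonneg v hv e' hev' _ (edge_subset heu'' (end_mem (fr := fr) huP heu''))
    have h4 : u - v = fr.len v e • fr.rdir v e := by rw [hu, opp, add_sub_cancel_left]
    rw [add_sub_right_comm, h4, map_add, map_smul, map_smul, coord_rdir hv hev' hev, if_neg hne,
      smul_zero, zero_add, smul_eq_mul] at h3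
    exact nonneg_of_mul_nonneg_right h3 (fr.len_pos u huP e'' heu'')
  have hprod : fr.coord u e'' (fr.rdir v e') * fr.coord v e' (fr.rdir u e'') = 1 := by
    have h3 := congrArg (fr.coord v e') h2
    rw [map_add, map_smul, map_smul, hneg, map_neg, coord_rdir hv hev' hev, if_neg hne,
      coord_rdir hv hev' hev', if_pos rfl, neg_zero, smul_zero, zero_add, smul_eq_mul] at h3
    exact h3.symm
  obtain ⟨α, hα'⟩ := fr.coord_int v e' (fr.dir u e'')
  obtain ⟨β, hβ'⟩ := fr.coord_int u e'' (fr.dir v e')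
  rw [← rdir] at hα' hβ'
  have hα1 : α = 1 := by
    rw [hα', hβ'] at hprod
    rw [hα'] at hα
    have h5 : β * α = 1 := by exact_mod_cast hprod
    have h6 : 0 ≤ α := by exact_mod_cast hα
    rcases Int.eq_one_or_neg_one_of_mul_eq_one' h5 with h | h <;> omega
  rw [hα', hα1] at h1
  refine ⟨-fr.coord v e (fr.rdir u e''), ?_⟩
  generalize fr.coord v e (fr.rdir u e'') = c at h1 ⊢
  rw [h1]
  simp

/-! ### Two-dimensional faces -/

/-- The area form on the plane of a two-dimensional face, in the coordinates `s`, `t`. -/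
def area (s t : (Fin n → ℝ) →ₗ[ℝ] ℝ) (x y : Fin n → ℝ) : ℝ := s x * t y - s y * t x

/-- The directions at `u` and at `v` are integer combinations of each other within the plane of `Q`,
so the two change-of-basis determinants are integers with product 1. -/
theorem area_rdir (hQ : Q ∈ faces P 2) (hv : v ∈ vertices P) (hvQ : v ∈ Q)
    (hu : u ∈ vertices P) (huQ : u ∈ Q) {e₁ e₂ f₁ f₂ : Set (Fin n → ℝ)} (hne : e₁ ≠ e₂)
    (he₁ : e₁ ∈ fr.edgesIn Q v) (he₂ : e₂ ∈ fr.edgesIn Q v) (hne' : f₁ ≠ f₂)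
    (hf₁ : f₁ ∈ fr.edgesIn Q u) (hf₂ : f₂ ∈ fr.edgesIn Q u) :
    area (fr.coord v e₁) (fr.coord v e₂) (fr.rdir u f₁) (fr.rdir u f₂) = 1 ∨
      area (fr.coord v e₁) (fr.coord v e₂) (fr.rdir u f₁) (fr.rdir u f₂) = -1 := by
  classical
  have hpair : fr.edgesIn Q u = {f₁, f₂} := by
    obtain ⟨f, hf, hE⟩ := exists_edgesIn_eq_pair hQ hu huQ hf₁
    rw [hE, Finset.mem_insert, Finset.mem_singleton] at hf₂
    rw [hE, hf₂.resolve_left hne'.symm]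
  have h1 := rdir_eq_sum hQ.2.1 hu huQ hv hvQ he₁
  have h2 := rdir_eq_sum hQ.2.1 hu huQ hv hvQ he₂
  rw [hpair, Finset.sum_pair hne'] at h1 h2
  have he₁' := (fr.mem_edgesIn.1 he₁).1
  have he₂' := (fr.mem_edgesIn.1 he₂).1
  have k1 := congrArg (fr.coord v e₁) h1
  have k2 := congrArg (fr.coord v e₂) h1
  have k3 := congrArg (fr.coord v e₁) h2
  have k4 := congrArg (fr.coord v e₂) h2
  simp only [map_add, map_smul, smul_eq_mul, coord_rdir hv he₁' he₁', coord_rdir hv he₂' he₂',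
    coord_rdir hv he₁' he₂', coord_rdir hv he₂' he₁', if_pos, if_neg hne, if_neg hne.symm]
    at k1 k2 k3 k4
  obtain ⟨a, ha⟩ := fr.coord_int u f₁ (fr.dir v e₁)
  obtain ⟨b, hb⟩ := fr.coord_int u f₂ (fr.dir v e₁)
  obtain ⟨c, hc⟩ := fr.coord_int u f₁ (fr.dir v e₂)
  obtain ⟨d, hd⟩ := fr.coord_int u f₂ (fr.dir v e₂)
  obtain ⟨p, hp⟩ := fr.coord_int v e₁ (fr.dir u f₁)
  obtain ⟨q, hq⟩ := fr.coord_int v e₂ (fr.dir u f₁)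
  obtain ⟨p', hp'⟩ := fr.coord_int v e₁ (fr.dir u f₂)
  obtain ⟨q', hq'⟩ := fr.coord_int v e₂ (fr.dir u f₂)
  simp only [rdir, ha, hb, hc, hd, hp, hq, hp', hq'] at k1 k2 k3 k4
  simp only [area, rdir, hp, hq, hp', hq']
  have hdet : (a * d - b * c) * (p * q' - p' * q) = 1 := by
    have : ((a : ℝ) * d - b * c) * (p * q' - p' * q) = 1 := by
      calc ((a : ℝ) * d - b * c) * (p * q' - p' * q)
          = (a * p + b * p') * (c * q + d * q') - (a * q + b * q') * (c * p + d * p') := by ring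
        _ = 1 := by rw [← k1, ← k2, ← k3, ← k4]; ring
    exact_mod_cast this
  rcases Int.eq_one_or_neg_one_of_mul_eq_one' hdet with ⟨-, h⟩ | ⟨-, h⟩
  · left; exact_mod_cast h
  · right; exact_mod_cast h

theorem area_swap (s t : (Fin n → ℝ) →ₗ[ℝ] ℝ) (x y : Fin n → ℝ) : area s t y x = -area s t x y := by
  unfold area; ring

/-- At the other end of an edge its direction is reversed and its neighbour changes by a multiple of
it, so the orientation of the pair flips. This sign makes the potential telescope. -/
theorem area_transport (s t : (Fin n → ℝ) →ₗ[ℝ] ℝ) {x y z : Fin n → ℝ} {b : ℝ}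
    (h : y - z = b • x) : area s t (-x) z = -area s t x y := by
  obtain rfl : y = z + b • x := by rw [← h]; abel
  simp only [area, map_neg, map_add, map_smul, smul_eq_mul]
  ring

-- The smooth polygon identity. At a vertex, reciprocity replaces the two ratios by a difference of
-- potentials, a constant `-3`, and `6` when `ξ` has one sign on both edges. The differences cancel
-- along edges, and only the minimum and the maximum of `ξ` give a `6`.
open Classical in
theorem exists_functional_sum_ratio (hQ : Q ∈ faces P 2) :
    ∃ ξ : (Fin n → ℝ) →ₗ[ℝ] ℝ,
      (∀ v ∈ vertices P, v ∈ Q → ∀ e ∈ fr.edgesIn Q v, ξ (fr.rdir v e) ≠ 0) ∧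
      ∑ v ∈ fr.verts with v ∈ Q, ∑ e ∈ fr.edgesIn Q v, ∑ e' ∈ (fr.edgesIn Q v).erase e,
        ξ (fr.rdir v e') / ξ (fr.rdir v e) = 12 - 3 * ((fr.verts.filter (· ∈ Q)).card : ℝ) := by
  obtain ⟨v₀, hv₀, hv₀Q, -⟩ := exists_vertex_min fr.polytope hQ.2.1 hQ.1 0
  obtain ⟨e₁, e₂, hne, hE₀⟩ := Finset.card_eq_two.1
    (show (fr.edgesIn Q v₀).card = 2 by rw [card_edgesIn hQ.2.1 hv₀ hv₀Q, hQ.2.2])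
  have he₁ : e₁ ∈ fr.edgesIn Q v₀ := by simp [hE₀]
  have he₂ : e₂ ∈ fr.edgesIn Q v₀ := by simp [hE₀]
  set s := fr.coord v₀ e₁
  set t := fr.coord v₀ e₂
  choose S hS using fr.coord_int v₀ e₁
  choose T hT using fr.coord_int v₀ e₂
  have hpairs : ∀ v ∈ vertices P, v ∈ Q → ∀ e ∈ fr.edgesIn Q v, ∀ e' ∈ fr.edgesIn Q v, e ≠ e' →
      area s t (fr.rdir v e) (fr.rdir v e') = 1 ∨ area s t (fr.rdir v e) (fr.rdir v e') = -1 :=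
    fun v hv hvQ e he e' he' h => area_rdir hQ hv₀ hv₀Q hv hvQ hne he₁ he₂ h he he'
  have hST : ∀ v ∈ vertices P, v ∈ Q → ∀ e ∈ fr.edgesIn Q v,
      S (fr.dir v e) = 0 → T (fr.dir v e) ≠ 0 := by
    intro v hv hvQ e he h1 h2
    obtain ⟨e', h, hE⟩ := exists_edgesIn_eq_pair hQ hv hvQ he
    have := hpairs v hv hvQ e he e' (by simp [hE]) h
    simp only [area, rdir, s, t, hS, hT, h1, h2] at this
    norm_num at this
  -- The integer `N` avoids all slopes at which `t + N s` would vanish on an edge direction. Integer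
  -- division suffices, since at such a slope it is exact.
  obtain ⟨N, hN⟩ := Infinite.exists_notMem_finset
    ((fr.verts ×ˢ fr.faceSet 1).image fun x => -T (fr.dir x.1 x.2) / S (fr.dir x.1 x.2))
  set q : (Fin n → ℤ) → ℤ := fun w => T w + N * S w with hq
  have hq0 : ∀ v ∈ vertices P, v ∈ Q → ∀ e ∈ fr.edgesIn Q v, q (fr.dir v e) ≠ 0 := by
    intro v hv hvQ e he h
    by_cases hS0 : S (fr.dir v e) = 0
    · exact hST v hv hvQ e he hS0 (by simpa [hq, hS0] using h)
    · refine hN (Finset.mem_image.2 ⟨(v, e), Finset.mem_product.2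
        ⟨fr.mem_verts.2 hv, fr.mem_faceSet.2 (fr.mem_edgesIn.1 he).1.1⟩, ?_⟩)
      refine Int.ediv_eq_of_eq_mul_left hS0 ?_
      simp only [hq] at h
      linarith
  set ξ : (Fin n → ℝ) →ₗ[ℝ] ℝ := t + (N : ℝ) • s with hξ
  have hξq : ∀ w, ξ (toReal w) = q w := by
    intro w
    simp only [hξ, LinearMap.add_apply, LinearMap.smul_apply, s, t, hS, hT, hq, smul_eq_mul]
    push_cast
    ring
  have hξ0 : ∀ v ∈ vertices P, v ∈ Q → ∀ e ∈ fr.edgesIn Q v, ξ (fr.rdir v e) ≠ 0 := by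
    intro v hv hvQ e he
    rw [rdir, hξq]
    exact_mod_cast hq0 v hv hvQ e he
  refine ⟨ξ, hξ0, ?_⟩
  obtain ⟨G, hGeven, hG⟩ := exists_planar_potential
  set Γ : (Fin n → ℝ) → Set (Fin n → ℝ) → ℝ := fun v e => G (S (fr.dir v e)) (q (fr.dir v e)) with hΓ
  have hpot : ∀ v ∈ vertices P, v ∈ Q → ∀ e ∈ fr.edgesIn Q v, ∀ e' ∈ fr.edgesIn Q v,
      area s t (fr.rdir v e) (fr.rdir v e') = 1 →
      ξ (fr.rdir v e') / ξ (fr.rdir v e) + ξ (fr.rdir v e) / ξ (fr.rdir v e') + 3 =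
        Γ v e - Γ v e' + if 0 < ξ (fr.rdir v e) * ξ (fr.rdir v e') then 6 else 0 := by
    intro v hv hvQ e he e' he' ha
    have hdet : S (fr.dir v e) * q (fr.dir v e') - S (fr.dir v e') * q (fr.dir v e) = 1 := by
      simp only [area, rdir, s, t, hS, hT] at ha
      have ha' : S (fr.dir v e) * T (fr.dir v e') - S (fr.dir v e') * T (fr.dir v e) = 1 := by
        exact_mod_cast ha
      simp only [hq]
      linear_combination ha'
    have h := hG _ _ _ _ hdet (hq0 v hv hvQ e he) (hq0 v hv hvQ e' he')
    have hif : (0 < ξ (fr.rdir v e) * ξ (fr.rdir v e')) ↔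
        0 < q (fr.dir v e) * q (fr.dir v e') := by
      simp only [rdir, hξq]
      exact_mod_cast Iff.rfl
    rw [if_congr hif rfl rfl]
    simp only [rdir, hξq, hΓ]
    rw [h]
    ring
  -- The inner sum has a single term: `σ v e` is the orientation sign of `e` relative to the other
  -- edge of `Q` at `v`.
  set σ : (Fin n → ℝ) → Set (Fin n → ℝ) → ℝ := fun v e =>
    ∑ e' ∈ (fr.edgesIn Q v).erase e, area s t (fr.rdir v e) (fr.rdir v e') with hσ
  have hvertex : ∀ v ∈ fr.verts.filter (· ∈ Q),
      ∑ e ∈ fr.edgesIn Q v, ∑ e' ∈ (fr.edgesIn Q v).erase e, ξ (fr.rdir v e') / ξ (fr.rdir v e) =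
      ∑ e ∈ fr.edgesIn Q v, σ v e * Γ v e - 3 +
        ((if ∀ e ∈ fr.edgesIn Q v, 0 < ξ (fr.rdir v e) then 6 else 0) +
          if ∀ e ∈ fr.edgesIn Q v, 0 < (-ξ) (fr.rdir v e) then 6 else 0) := by
    intro v hv
    obtain ⟨hv, hvQ⟩ := Finset.mem_filter.1 hv
    rw [mem_verts] at hv
    obtain ⟨a, b, hab, hE⟩ := Finset.card_eq_two.1
      (show (fr.edgesIn Q v).card = 2 by rw [card_edgesIn hQ.2.1 hv hvQ, hQ.2.2])
    have ha : a ∈ fr.edgesIn Q v := by simp [hE]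
    have hb : b ∈ fr.edgesIn Q v := by simp [hE]
    have ea : (fr.edgesIn Q v).erase a = {b} := by
      rw [hE, Finset.erase_insert (by simpa using hab)]
    have eb : (fr.edgesIn Q v).erase b = {a} := by
      rw [hE, Finset.pair_comm, Finset.erase_insert (by simpa using hab.symm)]
    have hind : ((if ∀ e ∈ fr.edgesIn Q v, 0 < ξ (fr.rdir v e) then (6 : ℝ) else 0) +
        if ∀ e ∈ fr.edgesIn Q v, 0 < (-ξ) (fr.rdir v e) then (6 : ℝ) else 0) =
        if 0 < ξ (fr.rdir v a) * ξ (fr.rdir v b) then 6 else 0 := by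
      simp only [hE, Finset.mem_insert, Finset.mem_singleton, forall_eq_or_imp, forall_eq,
        LinearMap.neg_apply, neg_pos, mul_pos_iff]
      by_cases h1 : 0 < ξ (fr.rdir v a) ∧ 0 < ξ (fr.rdir v b)
      · have h2 : ¬ (ξ (fr.rdir v a) < 0 ∧ ξ (fr.rdir v b) < 0) := fun h => h.1.not_gt h1.1
        simp [h1, h2]
      · simp [h1]
    rw [hind]
    simp only [hσ]
    rw [hE, Finset.sum_pair hab, Finset.sum_pair hab, ← hE, ea, eb, Finset.sum_singleton,
      Finset.sum_singleton, Finset.sum_singleton, Finset.sum_singleton]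
    have hsw := area_swap s t (fr.rdir v a) (fr.rdir v b)
    rcases hpairs v hv hvQ a ha b hb hab with h | h
    · have := hpot v hv hvQ a ha b hb h
      rw [hsw, h]
      linarith
    · have := hpot v hv hvQ b hb a ha (by rw [hsw, h, neg_neg])
      rw [mul_comm (ξ (fr.rdir v a))]
      rw [hsw, h]
      linarith
  -- Regrouped by edges, each edge contributes its potential twice: the potential is even, so equal
  -- at both ends, while the orientation sign is opposite.
  have htel : ∑ v ∈ fr.verts with v ∈ Q, ∑ e ∈ fr.edgesIn Q v, σ v e * Γ v e = 0 := by
    rw [sum_flags]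
    refine Finset.sum_eq_zero fun e he => ?_
    obtain ⟨he1, heQ⟩ := Finset.mem_filter.1 he
    obtain ⟨v, hv, hev⟩ := exists_vertex_of_edge fr.polytope (fr.mem_faceSet.1 he1)
    rw [sum_vertices_edge hv hev]
    have hvQ : v ∈ Q := heQ hev.2
    have heI : e ∈ fr.edgesIn Q v := fr.mem_edgesIn.2 ⟨hev, heQ⟩
    obtain ⟨huQ, heu⟩ := opp_mem hv heI
    have hu := opp_mem_vertices (fr := fr) hv hev
    obtain ⟨-, -, hneg⟩ := rdir_opp_and_len (fr := fr) hv hev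
    obtain ⟨a, hea, hE⟩ := exists_edgesIn_eq_pair hQ hv hvQ heI
    obtain ⟨b, heb, hE'⟩ := exists_edgesIn_eq_pair hQ hu huQ heu
    have hdir : fr.dir (fr.opp v e) e = -fr.dir v e :=
      toReal_injective (by rw [toReal_neg]; exact hneg)
    have hSneg : ∀ w, S (-w) = -S w := fun w => by
      have h := hS (-w)
      rw [toReal_neg, map_neg, hS w] at h
      exact_mod_cast h.symm
    have hTneg : ∀ w, T (-w) = -T w := fun w => by
      have h := hT (-w)
      rw [toReal_neg, map_neg, hT w] at h
      exact_mod_cast h.symm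
    have hΓeq : Γ (fr.opp v e) e = Γ v e := by
      have hqneg : q (-fr.dir v e) = -q (fr.dir v e) := by
        simp only [hq, hSneg, hTneg]
        ring
      simp only [hΓ]
      rw [hdir, hqneg, hSneg, hGeven]
    have hσeq : σ (fr.opp v e) e = -σ v e := by
      obtain ⟨c, hc⟩ := exists_sub_eq_smul hQ hv hvQ heI (e' := a) (e'' := b) (by simp [hE])
        hea.symm (by simp [hE']) heb.symm
      simp only [hσ]
      rw [hE, hE', Finset.erase_insert (by simpa using heb), Finset.erase_insert (by simpa using hea),
        Finset.sum_singleton, Finset.sum_singleton, hneg, area_transport s t hc]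
    rw [hΓeq, hσeq]
    ring
  have hcount : ∀ l : (Fin n → ℝ) →ₗ[ℝ] ℝ,
      (∀ v ∈ vertices P, v ∈ Q → ∀ e ∈ fr.edgesIn Q v, l (fr.rdir v e) ≠ 0) →
      ∑ v ∈ fr.verts with v ∈ Q,
        (if ∀ e ∈ fr.edgesIn Q v, 0 < l (fr.rdir v e) then (6 : ℝ) else 0) = 6 := by
    intro l hl
    obtain ⟨m, ⟨hm, hmQ, hpos⟩, huniq⟩ := exists_unique_vertex_min (fr := fr) hQ.2.1 hQ.1 l hl
    rw [Finset.sum_eq_single m]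
    · rw [if_pos hpos]
    · intro v hv hvm
      simp only [Finset.mem_filter, mem_verts] at hv
      exact if_neg fun h => hvm (huniq v ⟨hv.1, hv.2, h⟩)
    · intro h
      simp [hm, hmQ] at h
  rw [Finset.sum_congr rfl hvertex, Finset.sum_add_distrib, Finset.sum_sub_distrib, htel,
    Finset.sum_add_distrib, hcount ξ hξ0, hcount (-ξ) fun v hv hvQ e he => by
      simpa using hξ0 v hv hvQ e he, Finset.sum_const, nsmul_eq_mul]
  ring

open Classical in
/-- A two-dimensional face has as many vertices as edges. -/
theorem card_vertices_eq_card_edges (hQ : Q ∈ faces P 2) :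
    (fr.verts.filter (· ∈ Q)).card = ((fr.faceSet 1).filter (· ⊆ Q)).card := by
  have h := sum_flags fr Q (fun _ _ => 1)
  have h1 : ∀ v ∈ fr.verts.filter (· ∈ Q), ∑ e ∈ fr.edgesIn Q v, 1 = 2 := by
    intro v hv
    simp only [Finset.mem_filter, mem_verts] at hv
    rw [Finset.sum_const, card_edgesIn hQ.2.1 hv.1 hv.2, hQ.2.2]
    rfl
  have h2 : ∀ e ∈ (fr.faceSet 1).filter (· ⊆ Q), ∑ v ∈ fr.verts with v ∈ e, 1 = 2 := by
    intro e he
    simp only [Finset.mem_filter, mem_faceSet] at he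
    obtain ⟨v, hv, hev⟩ := exists_vertex_of_edge fr.polytope he.1
    rw [sum_vertices_edge hv hev]
  rw [Finset.sum_congr rfl h1, Finset.sum_congr rfl h2, Finset.sum_const, Finset.sum_const,
    smul_eq_mul, smul_eq_mul] at h
  omega

end Framing

end DelzantReflexive

end

/-! ### Reflexivity: edge lengths as sums over two-dimensional faces. -/

noncomputable section

namespace DelzantReflexive

namespace Framing

variable {n : ℕ} {P : Set (Fin n → ℝ)} {fr : Framing P} {v u : Fin n → ℝ}
  {e f F Q : Set (Fin n → ℝ)}

/-! ### Edge lengths of reflexive polytopes -/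

/-- The edges at `v` other than `e` span a facet, whose primitive outward normal is minus the
coordinate of `e`. Its value at `v` is an integer, at most 1 by reflexivity and positive because the
origin is interior. -/
theorem coord_vertex_of_isReflexive (hR : IsReflexive P) (hv : v ∈ vertices P)
    (he : e ∈ edgesAt P v) : fr.coord v e v = -1 := by
  classical
  obtain ⟨l, hl, hP⟩ := hR.eq_iInter
  obtain ⟨F, hF, hvF, hE⟩ := exists_face_of_subset (fr := fr) hv
    (Finset.erase_subset e (fr.edges v))
  rw [Finset.card_erase_of_mem (fr.mem_edges.2 he), card_edges_eq fr hv] at hF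
  obtain ⟨hprim, m, hm, hFm⟩ := hl ⟨F, hF⟩
  have hvP : v ∈ P := edge_subset he he.2
  have hle : v ⬝ᵥ toReal (l ⟨F, hF⟩) ≤ 1 := by
    have h := hvP
    rw [hP, Set.mem_iInter] at h
    exact h ⟨F, hF⟩
  generalize l ⟨F, hF⟩ = w at hprim hm hFm hle
  simp only at hFm
  let L : (Fin n → ℝ) →ₗ[ℝ] ℝ :=
    { toFun := fun x => x ⬝ᵥ toReal w
      map_add' := fun x y => add_dotProduct x y _
      map_smul' := fun c x => smul_dotProduct c x _ }
  have hLv : L v = m := by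
    rw [hFm] at hvF
    exact hvF.2
  have hend : ∀ f ∈ edgesAt P v, L (v + fr.len v f • fr.rdir v f) ≤ m := fun f hf =>
    hm _ (edge_subset hf (end_mem (fr := fr) hv hf))
  have hLne : ∀ f ∈ edgesAt P v, f ≠ e → L (fr.rdir v f) = 0 := by
    intro f hf hfe
    have h1 : f ∈ fr.edgesIn F v := by rw [hE]; simp [hfe, hf]
    have h2 := (fr.mem_edgesIn.1 h1).2 (end_mem (fr := fr) hv hf)
    rw [hFm] at h2
    have h3 : L (v + fr.len v f • fr.rdir v f) = m := h2.2
    rw [map_add, hLv, map_smul, smul_eq_mul, add_eq_left] at h3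
    exact (mul_eq_zero.1 h3).resolve_left (fr.len_pos v hv f hf).ne'
  have hLcoord : ∀ x, L x = L (fr.rdir v e) * fr.coord v e x := by
    intro x
    rw [map_eq_sum (fr := fr) hv L x, Finset.sum_eq_single e, mul_comm]
    · intro f hf hfe
      rw [hLne f (fr.mem_edges.1 hf) hfe, mul_zero]
    · intro h
      exact absurd (fr.mem_edges.2 he) h
  obtain ⟨K, hK⟩ : ∃ K : ℤ, L (fr.rdir v e) = K :=
    ⟨∑ i, fr.dir v e i * w i, by simp [L, rdir, toReal, dotProduct]⟩
  have hKneg : K < 0 := by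
    have hlen := fr.len_pos v hv e he
    have h1 := hend e he
    rw [map_add, hLv, map_smul, smul_eq_mul, hK] at h1
    have h2 : (K : ℝ) ≤ 0 := by
      by_contra h
      nlinarith [mul_pos hlen (not_le.1 h)]
    refine lt_of_le_of_ne (by exact_mod_cast h2) fun h0 => ?_
    have h3 : e ∈ fr.edgesIn F v := by
      refine fr.mem_edgesIn.2 ⟨he, fun y hy => ?_⟩
      rw [hFm]
      refine ⟨edge_subset he hy, ?_⟩
      change L y = m
      rw [hLcoord, hK, h0, ← hLv, hLcoord v, hK, h0]
      simp
    rw [hE] at h3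
    simp at h3
  -- The normal is `K` times the integral covector `coord v e`, so primitivity leaves only `K = ±1`.
  have hK1 : K = -1 := by
    choose c hc using fr.coord_int v e
    have hw : w = K • (fun i => c (Pi.single i 1)) := by
      ext i
      have h1 := hLcoord (toReal (Pi.single i 1))
      have h2 : toReal (Pi.single i (1 : ℤ)) = Pi.single i (1 : ℝ) := by
        ext j
        simp [toReal, Pi.single_apply]
      have h3 : L (toReal (Pi.single i 1)) = w i := by
        rw [h2]
        simp [L, toReal]
      rw [h3, hK, hc] at h1
      simp only [Pi.smul_apply, smul_eq_mul]
      exact_mod_cast h1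
    rcases hprim K _ hw with h | h <;> omega
  have hLneg : ∀ x, L x = -fr.coord v e x := by
    intro x
    rw [hLcoord, hK, hK1]
    simp
  -- For small `t > 0` the point `-t • rdir v e` lies in `P`, and `L` takes the value `t` there.
  have hmpos : 0 < m := by
    have h1 : P ∈ nhds (0 : Fin n → ℝ) := mem_interior_iff_mem_nhds.1 hR.zero_mem_interior
    have h2 : Filter.Tendsto (fun t : ℝ => -t • fr.rdir v e) (nhds 0) (nhds 0) := by
      have : Continuous fun t : ℝ => -t • fr.rdir v e := by fun_prop
      simpa using this.tendsto 0
    have h3 := (h2.eventually h1).filter_mono (nhdsWithin_le_nhds (s := Set.Ioi 0))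
    obtain ⟨t, htP, ht⟩ := (h3.and self_mem_nhdsWithin).exists
    have h4 : L (-t • fr.rdir v e) ≤ m := hm _ htP
    rw [hLneg, map_smul, coord_rdir hv he he, if_pos rfl] at h4
    simp at h4
    exact lt_of_lt_of_le ht h4
  obtain ⟨x, hx⟩ := hR.integral v hv
  obtain ⟨k, hk⟩ := fr.coord_int v e x
  rw [← hx] at hk
  have hle' : m ≤ 1 := hLv ▸ hle
  rw [hLneg, hk] at hLv
  have h5 : 0 < -k := by
    have : (0 : ℝ) < ((-k : ℤ) : ℝ) := by push_cast; linarith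
    exact_mod_cast this
  have h6 : -k ≤ 1 := by
    have : ((-k : ℤ) : ℝ) ≤ ((1 : ℤ) : ℝ) := by push_cast; linarith
    exact_mod_cast this
  have h7 : k = -1 := by omega
  rw [hk, h7]
  simp

/-- A vertex of a Delzant reflexive polytope is minus the sum of the primitive edge directions. -/
theorem vertex_eq_neg_sum (hR : IsReflexive P) (hv : v ∈ vertices P) :
    v = -∑ e ∈ fr.edges v, fr.rdir v e := by
  conv_lhs => rw [← sum_coord (fr := fr) hv v]
  rw [← Finset.sum_neg_distrib]
  refine Finset.sum_congr rfl fun e he => ?_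
  rw [coord_vertex_of_isReflexive hR hv (fr.mem_edges.1 he), neg_one_smul]

open Classical in
/-- The other edges at `v` correspond to the two-dimensional faces containing a given edge. -/
theorem sum_erase_edges {M : Type*} [AddCommMonoid M] (hv : v ∈ vertices P)
    (he : e ∈ edgesAt P v) (g : Set (Fin n → ℝ) → M) :
    ∑ f ∈ (fr.edges v).erase e, g f =
      ∑ Q ∈ fr.faceSet 2 with e ⊆ Q, ∑ f ∈ (fr.edgesIn Q v).erase e, g f := by
  have hswap : ∑ Q ∈ fr.faceSet 2 with e ⊆ Q, ∑ f ∈ (fr.edgesIn Q v).erase e, g f =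
      ∑ f ∈ (fr.edges v).erase e, ∑ Q ∈ fr.faceSet 2 with e ⊆ Q ∧ f ⊆ Q, g f := by
    refine Finset.sum_comm' fun Q f => ?_
    simp only [Finset.mem_filter, Finset.mem_erase, mem_edgesIn, mem_edges]
    tauto
  rw [hswap]
  refine Finset.sum_congr rfl fun f hf => ?_
  obtain ⟨hne, hf⟩ := Finset.mem_erase.1 hf
  have hsub : {e, f} ⊆ fr.edges v := by
    intro x hx
    rw [Finset.mem_insert, Finset.mem_singleton] at hx
    rcases hx with rfl | rfl
    · exact fr.mem_edges.2 he
    · exact hf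
  obtain ⟨Q, hQ, hvQ, hE⟩ := exists_face_of_subset (fr := fr) hv hsub
  rw [Finset.card_pair hne.symm] at hQ
  have : (fr.faceSet 2).filter (fun Q => e ⊆ Q ∧ f ⊆ Q) = {Q} := by
    ext Q'
    simp only [Finset.mem_filter, mem_faceSet, Finset.mem_singleton]
    constructor
    · rintro ⟨hQ', heQ', hfQ'⟩
      have hvQ' : v ∈ Q' := heQ' he.2
      refine face_ext (fr := fr) hQ'.2.1 hQ.2.1 hv hvQ' hvQ ?_
      rw [hE]
      refine (Finset.eq_of_subset_of_card_le ?_ ?_).symm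
      · intro x hx
        rw [Finset.mem_insert, Finset.mem_singleton] at hx
        rcases hx with rfl | rfl
        · exact fr.mem_edgesIn.2 ⟨he, heQ'⟩
        · exact fr.mem_edgesIn.2 ⟨fr.mem_edges.1 hf, hfQ'⟩
      · rw [card_edgesIn hQ'.2.1 hv hvQ', hQ'.2.2, Finset.card_pair hne.symm]
    · rintro rfl
      have h1 : e ∈ fr.edgesIn Q' v := by simp [hE]
      have h2 : f ∈ fr.edgesIn Q' v := by simp [hE]
      exact ⟨hQ, (fr.mem_edgesIn.1 h1).2, (fr.mem_edgesIn.1 h2).2⟩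
  rw [this, Finset.sum_singleton]

open Classical in
/-- The number of two-dimensional faces containing an edge. -/
theorem card_faces_two_of_edge (he : e ∈ faces P 1) :
    (((fr.faceSet 2).filter (e ⊆ ·)).card : ℝ) = n - 1 := by
  obtain ⟨v, hv, hev⟩ := exists_vertex_of_edge fr.polytope he
  have h := sum_erase_edges (fr := fr) hv hev (fun _ => (1 : ℝ))
  have h1 : ∀ Q ∈ (fr.faceSet 2).filter (e ⊆ ·),
      ∑ f ∈ (fr.edgesIn Q v).erase e, (1 : ℝ) = 1 := by
    intro Q hQ
    simp only [Finset.mem_filter, mem_faceSet] at hQ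
    have hI : e ∈ fr.edgesIn Q v := fr.mem_edgesIn.2 ⟨hev, hQ.2⟩
    rw [Finset.sum_const, Finset.card_erase_of_mem hI,
      card_edgesIn hQ.1.2.1 hv (hQ.2 hev.2), hQ.1.2.2]
    simp
  rw [Finset.sum_congr rfl h1] at h
  simp only [Finset.sum_const, nsmul_eq_mul, mul_one] at h
  rw [← h, Finset.cast_card_erase_of_mem (fr.mem_edges.2 hev)]
  congr 1
  exact_mod_cast card_edges_eq fr hv

open Classical in
/-- The contribution of a two-dimensional face `Q` to the length of its edge `e`, computed by a
functional. -/
def contribution (fr : Framing P) (ξ : (Fin n → ℝ) →ₗ[ℝ] ℝ) (Q e : Set (Fin n → ℝ)) : ℝ :=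
  ∑ v ∈ fr.verts with v ∈ e, ∑ e' ∈ (fr.edgesIn Q v).erase e,
    ξ (fr.rdir v e') / ξ (fr.rdir v e)

-- The two neighbours of `e` in `Q` differ by a multiple of its direction, and applying `ξ` computes
-- this multiple. The difference becomes the sum in `contribution` because the direction of `e` is
-- reversed at the far end.
open Classical in
theorem sum_sub_sum_eq_contribution_smul (hQ : Q ∈ faces P 2) (hv : v ∈ vertices P)
    (he : e ∈ edgesAt P v) (heQ : e ⊆ Q) {ξ : (Fin n → ℝ) →ₗ[ℝ] ℝ}
    (hξ : ξ (fr.rdir v e) ≠ 0) :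
    ∑ f ∈ (fr.edgesIn Q v).erase e, fr.rdir v f -
      ∑ f ∈ (fr.edgesIn Q (fr.opp v e)).erase e, fr.rdir (fr.opp v e) f =
        fr.contribution ξ Q e • fr.rdir v e := by
  have hvQ : v ∈ Q := heQ he.2
  have heI : e ∈ fr.edgesIn Q v := fr.mem_edgesIn.2 ⟨he, heQ⟩
  obtain ⟨huQ, heu⟩ := opp_mem hv heI
  have hu := opp_mem_vertices (fr := fr) hv he
  obtain ⟨-, -, hneg⟩ := rdir_opp_and_len (fr := fr) hv he
  obtain ⟨a, hea, hE⟩ := exists_edgesIn_eq_pair hQ hv hvQ heI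
  obtain ⟨b, heb, hE'⟩ := exists_edgesIn_eq_pair hQ hu huQ heu
  obtain ⟨c, hc⟩ := exists_sub_eq_smul hQ hv hvQ heI (e' := a) (e'' := b) (by simp [hE])
    hea.symm (by simp [hE']) heb.symm
  rw [contribution, sum_vertices_edge hv he, hE, hE', Finset.erase_insert (by simpa using hea),
    Finset.erase_insert (by simpa using heb), Finset.sum_singleton, Finset.sum_singleton,
    Finset.sum_singleton, Finset.sum_singleton, hc, hneg]
  congr 1
  have h := congrArg ξ hc
  rw [map_sub, map_smul, smul_eq_mul] at h
  rw [map_neg, div_neg, ← sub_eq_add_neg, ← sub_div, h, mul_div_cancel_right₀ _ hξ]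

-- Subtract `v = -∑ w` at the two ends of `e`: the edge itself gives the 2, and the remaining edges
-- are grouped by the 2-faces through `e`. A separate functional may be used for each 2-face.
open Classical in
theorem relativeLength_eq (hR : IsReflexive P) (he : e ∈ faces P 1)
    (ξ : Set (Fin n → ℝ) → (Fin n → ℝ) →ₗ[ℝ] ℝ)
    (hξ : ∀ Q ∈ faces P 2, ∀ v ∈ vertices P, v ∈ Q → ∀ e ∈ fr.edgesIn Q v,
      ξ Q (fr.rdir v e) ≠ 0) :
    relativeLength e = 2 + ∑ Q ∈ fr.faceSet 2 with e ⊆ Q, fr.contribution (ξ Q) Q e := by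
  obtain ⟨v, hv, hev⟩ := exists_vertex_of_edge fr.polytope he
  have hu := opp_mem_vertices (fr := fr) hv hev
  have heu := mem_edgesAt_opp (fr := fr) hv hev
  obtain ⟨-, -, hneg⟩ := rdir_opp_and_len (fr := fr) hv hev
  rw [relativeLength_eq_len hv hev]
  have h1 : fr.opp v e - v = fr.len v e • fr.rdir v e := by rw [opp, add_sub_cancel_left]
  have h2 := vertex_eq_neg_sum (fr := fr) hR hv
  have h3 := vertex_eq_neg_sum (fr := fr) hR hu
  rw [← Finset.add_sum_erase _ _ (fr.mem_edges.2 hev), sum_erase_edges hv hev] at h2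
  rw [← Finset.add_sum_erase _ _ (fr.mem_edges.2 heu), sum_erase_edges hu heu, hneg] at h3
  have h4 : ∑ Q ∈ fr.faceSet 2 with e ⊆ Q, ∑ f ∈ (fr.edgesIn Q v).erase e, fr.rdir v f -
      ∑ Q ∈ fr.faceSet 2 with e ⊆ Q,
        ∑ f ∈ (fr.edgesIn Q (fr.opp v e)).erase e, fr.rdir (fr.opp v e) f =
      (∑ Q ∈ fr.faceSet 2 with e ⊆ Q, fr.contribution (ξ Q) Q e) • fr.rdir v e := by
    rw [← Finset.sum_sub_distrib, Finset.sum_smul]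
    refine Finset.sum_congr rfl fun Q hQ => ?_
    simp only [Finset.mem_filter, mem_faceSet] at hQ
    exact sum_sub_sum_eq_contribution_smul hQ.1 hv hev hQ.2
      (hξ Q hQ.1 v hv (hQ.2 hev.2) e (fr.mem_edgesIn.2 ⟨hev, hQ.2⟩))
  refine smul_left_injective ℝ (rdir_ne_zero (fr := fr) hv hev) ?_
  simp only
  rw [← h1, add_smul, ← h4, two_smul]
  generalize ∑ Q ∈ fr.faceSet 2 with e ⊆ Q, ∑ f ∈ (fr.edgesIn Q v).erase e, fr.rdir v f = A at h2 ⊢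
  generalize ∑ Q ∈ fr.faceSet 2 with e ⊆ Q,
    ∑ f ∈ (fr.edgesIn Q (fr.opp v e)).erase e, fr.rdir (fr.opp v e) f = B at h3 ⊢
  generalize fr.opp v e = u at h3 ⊢
  generalize fr.rdir v e = d at h2 h3 ⊢
  rw [h2, h3]
  abel

/-- Exchanging the sums over edges and 2-faces gives `2 f₁ + 12 f₂` minus three times the number of
incident pairs, which is `(n-1) f₁`. -/
theorem sum_relativeLength (fr : Framing P) (hR : IsReflexive P) :
    ∑ e ∈ fr.faceSet 1, relativeLength e =
      12 * (fVector P 2 : ℝ) + (5 - 3 * (n : ℝ)) * (fVector P 1 : ℝ) := by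
  classical
  choose! ξ hξ hsum using fun Q (hQ : Q ∈ faces P 2) =>
    exists_functional_sum_ratio (fr := fr) hQ
  have hswap : ∀ g : Set (Fin n → ℝ) → Set (Fin n → ℝ) → ℝ,
      ∑ e ∈ fr.faceSet 1, ∑ Q ∈ fr.faceSet 2 with e ⊆ Q, g Q e =
        ∑ Q ∈ fr.faceSet 2, ∑ e ∈ fr.faceSet 1 with e ⊆ Q, g Q e := fun g =>
    Finset.sum_comm' fun e Q => by simp only [Finset.mem_filter]; tauto
  have hcontr : ∀ Q ∈ fr.faceSet 2, ∑ e ∈ fr.faceSet 1 with e ⊆ Q, fr.contribution (ξ Q) Q e =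
      12 - 3 * ∑ e ∈ fr.faceSet 1 with e ⊆ Q, (1 : ℝ) := by
    intro Q hQ
    rw [mem_faceSet] at hQ
    have h := hsum Q hQ
    rw [sum_flags, card_vertices_eq_card_edges hQ] at h
    rw [Finset.sum_const, nsmul_eq_mul, mul_one, ← h]
    rfl
  have hinc : ∑ e ∈ fr.faceSet 1, ∑ Q ∈ fr.faceSet 2 with e ⊆ Q, (1 : ℝ) =
      ((n : ℝ) - 1) * fVector P 1 := by
    have : ∀ e ∈ fr.faceSet 1, ∑ Q ∈ fr.faceSet 2 with e ⊆ Q, (1 : ℝ) = (n : ℝ) - 1 := by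
      intro e he
      rw [Finset.sum_const, nsmul_eq_mul, mul_one,
        card_faces_two_of_edge (fr.mem_faceSet.1 he)]
    rw [Finset.sum_congr rfl this, Finset.sum_const, card_faceSet, nsmul_eq_mul, mul_comm]
  rw [hswap] at hinc
  rw [Finset.sum_congr rfl fun e he => relativeLength_eq hR (fr.mem_faceSet.1 he) ξ hξ,
    Finset.sum_add_distrib, hswap, Finset.sum_congr rfl hcontr, Finset.sum_sub_distrib,
    ← Finset.mul_sum, hinc, Finset.sum_const, Finset.sum_const, card_faceSet, card_faceSet]
  simp only [nsmul_eq_mul]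
  ring

end Framing

end DelzantReflexive

end

/-! ### The `h`-vector through ascents of a generic functional. -/

noncomputable section

namespace DelzantReflexive

/-! ### The `h`-vector -/

/-- Binomial inversion: the product of binomials factors through `choose a (n-j)`, leaving an
alternating row sum that vanishes unless the row is the zeroth. -/
theorem sum_choose_mul_choose (n a j : ℕ) (ha : a ≤ n) (hj : j ≤ n) :
    ∑ i ∈ Finset.range (j + 1), (-1 : ℤ) ^ (j - i) * (Nat.choose (n - i) (n - j) : ℤ) *
      (Nat.choose a (n - i) : ℤ) = if a = n - j then 1 else 0 := by
  have h1 : ∀ i ∈ Finset.range (j + 1), (-1 : ℤ) ^ (j - i) * (Nat.choose (n - i) (n - j) : ℤ) *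
      (Nat.choose a (n - i) : ℤ) =
      (Nat.choose a (n - j) : ℤ) * ((-1) ^ (j - i) * (Nat.choose (a - (n - j)) (j - i) : ℤ)) := by
    intro i hi
    have hi' : i ≤ j := Nat.lt_succ_iff.1 (Finset.mem_range.1 hi)
    rcases lt_or_ge a (n - i) with h | h
    · have : a - (n - j) < j - i ∨ a < n - j := by omega
      rcases this with h' | h'
      · rw [Nat.choose_eq_zero_of_lt h, Nat.choose_eq_zero_of_lt h']
        simp
      · rw [Nat.choose_eq_zero_of_lt h, Nat.choose_eq_zero_of_lt h']
        simp
    · have h2 := Nat.choose_mul (n := a) (show n - j ≤ n - i by omega)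
      rw [show n - i - (n - j) = j - i by omega] at h2
      have h3 : (Nat.choose a (n - i) : ℤ) * (Nat.choose (n - i) (n - j) : ℤ) =
          (Nat.choose a (n - j) : ℤ) * (Nat.choose (a - (n - j)) (j - i) : ℤ) := by
        exact_mod_cast h2
      linear_combination ((-1 : ℤ) ^ (j - i)) * h3
  have h2 := Finset.sum_range_reflect
    (fun k => (-1 : ℤ) ^ k * (Nat.choose (a - (n - j)) k : ℤ)) (j + 1)
  simp only [Nat.add_sub_cancel] at h2
  have h3 : ∑ k ∈ Finset.range (a - (n - j) + 1), (-1 : ℤ) ^ k * (Nat.choose (a - (n - j)) k : ℤ) =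
      ∑ k ∈ Finset.range (j + 1), (-1 : ℤ) ^ k * (Nat.choose (a - (n - j)) k : ℤ) := by
    refine Finset.sum_subset (Finset.range_mono (by omega)) fun k _ hk => ?_
    rw [Finset.mem_range, not_lt] at hk
    rw [Nat.choose_eq_zero_of_lt (by omega), Nat.cast_zero, mul_zero]
  rw [Finset.sum_congr rfl h1, ← Finset.mul_sum, h2, ← h3, Int.alternating_sum_range_choose]
  rcases lt_trichotomy a (n - j) with h | h | h
  · rw [Nat.choose_eq_zero_of_lt h, if_neg h.ne]
    simp
  · simp [h]
  · rw [if_neg (by omega), if_neg (by omega), mul_zero]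

namespace Framing

variable {n : ℕ} {P : Set (Fin n → ℝ)}

theorem exists_generic (fr : Framing P) : ∃ l : (Fin n → ℝ) →ₗ[ℝ] ℝ,
    ∀ v ∈ vertices P, ∀ e ∈ edgesAt P v, l (fr.rdir v e) ≠ 0 := by
  let ι := {x : (Fin n → ℝ) × Set (Fin n → ℝ) // x.1 ∈ vertices P ∧ x.2 ∈ edgesAt P x.1}
  have : Finite ι := by
    refine Set.Finite.subset
      ((vertices_finite fr.polytope).prod (fr.polytope.finite_faces 1)) ?_
    rintro x ⟨h1, h2⟩
    exact ⟨h1, h2.1⟩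
  obtain ⟨l, hl⟩ := Module.exists_dual_forall_apply_ne_zero (K := ℝ)
    (fun x : ι => fr.rdir x.1.1 x.1.2) fun x => rdir_ne_zero x.2.1 x.2.2
  exact ⟨l, fun v hv e he => hl ⟨(v, e), hv, he⟩⟩

open Classical in
/-- The number of edges at `v` along which `l` increases. -/
def ascents (fr : Framing P) (l : (Fin n → ℝ) →ₗ[ℝ] ℝ) (v : Fin n → ℝ) : ℕ :=
  ((fr.edges v).filter fun e => 0 < l (fr.rdir v e)).card

variable {fr : Framing P} {l : (Fin n → ℝ) →ₗ[ℝ] ℝ}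

theorem ascents_add_ascents_neg
    (hl : ∀ v ∈ vertices P, ∀ e ∈ edgesAt P v, l (fr.rdir v e) ≠ 0) {v : Fin n → ℝ}
    (hv : v ∈ vertices P) : fr.ascents l v + fr.ascents (-l) v = n := by
  classical
  rw [ascents, ascents]
  have : ∀ e ∈ fr.edges v, 0 < (-l) (fr.rdir v e) ↔ ¬ 0 < l (fr.rdir v e) := by
    intro e he
    rw [LinearMap.neg_apply, neg_pos, not_lt]
    exact ⟨le_of_lt, fun h => lt_of_le_of_ne h (hl v hv e (fr.mem_edges.1 he))⟩
  rw [Finset.filter_congr this, Finset.card_filter_add_card_filter_not]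
  exact card_edges_eq fr hv

/-- Each face is counted at its unique `l`-minimal vertex, and the `i`-faces with minimum `v`
correspond to the `i`-subsets of the ascending edges at `v`. -/
theorem fVector_eq_sum (hl : ∀ v ∈ vertices P, ∀ e ∈ edgesAt P v, l (fr.rdir v e) ≠ 0) (i : ℕ) :
    fVector P i = ∑ v ∈ fr.verts, Nat.choose (fr.ascents l v) i := by
  classical
  have hfiber : ∀ v ∈ fr.verts, Nat.choose (fr.ascents l v) i =
      ∑ F ∈ fr.faceSet i with v ∈ F ∧ ∀ e ∈ fr.edgesIn F v, 0 < l (fr.rdir v e), 1 := by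
    intro v hv
    rw [mem_verts] at hv
    rw [ascents, ← Finset.card_powersetCard, Finset.sum_const, smul_eq_mul, mul_one]
    symm
    refine Finset.card_nbij (fun F => fr.edgesIn F v) ?_ ?_ ?_
    · intro F hF
      simp only [Finset.coe_filter, Set.mem_ofPred_eq, mem_faceSet] at hF
      rw [Finset.mem_coe, Finset.mem_powersetCard]
      refine ⟨fun e he => Finset.mem_filter.2 ⟨?_, hF.2.2 e he⟩, ?_⟩
      · exact fr.mem_edges.2 (fr.mem_edgesIn.1 he).1
      · rw [card_edgesIn hF.1.2.1 hv hF.2.1, hF.1.2.2]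
    · intro F hF G hG h
      simp only [Finset.coe_filter, Set.mem_ofPred_eq, mem_faceSet] at hF hG
      exact face_ext hF.1.2.1 hG.1.2.1 hv hF.2.1 hG.2.1 h
    · intro I hI
      rw [Finset.mem_coe, Finset.mem_powersetCard] at hI
      obtain ⟨F, hF, hvF, hE⟩ := exists_face_of_subset (fr := fr) hv
        (hI.1.trans (Finset.filter_subset _ _))
      rw [hI.2] at hF
      refine ⟨F, ?_, hE⟩
      simp only [Finset.coe_filter, Set.mem_ofPred_eq, mem_faceSet]
      refine ⟨hF, hvF, fun e he => ?_⟩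
      rw [hE] at he
      exact (Finset.mem_filter.1 (hI.1 he)).2
  have hswap : ∑ v ∈ fr.verts,
      ∑ F ∈ fr.faceSet i with v ∈ F ∧ ∀ e ∈ fr.edgesIn F v, 0 < l (fr.rdir v e), 1 =
      ∑ F ∈ fr.faceSet i,
        ∑ v ∈ fr.verts with v ∈ F ∧ ∀ e ∈ fr.edgesIn F v, 0 < l (fr.rdir v e), 1 :=
    Finset.sum_comm' fun v F => by simp only [Finset.mem_filter]; tauto
  rw [Finset.sum_congr rfl hfiber, hswap, ← card_faceSet fr, Finset.card_eq_sum_ones]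
  refine Finset.sum_congr rfl fun F hF => ?_
  rw [mem_faceSet] at hF
  obtain ⟨m, ⟨hm, hmF, hpos⟩, huniq⟩ := exists_unique_vertex_min (fr := fr) hF.2.1 hF.1 l
    fun v hv _ e he => hl v hv e (fr.mem_edgesIn.1 he).1
  have : fr.verts.filter (fun v => v ∈ F ∧ ∀ e ∈ fr.edgesIn F v, 0 < l (fr.rdir v e)) = {m} := by
    ext v
    simp only [Finset.mem_filter, mem_verts, Finset.mem_singleton]
    exact ⟨fun h => huniq v h, fun h => h ▸ ⟨hm, hmF, hpos⟩⟩
  rw [this, Finset.sum_singleton]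

theorem ascents_le {v : Fin n → ℝ} (hv : v ∈ vertices P) : fr.ascents l v ≤ n := by
  exact (Finset.card_filter_le _ _).trans_eq (card_edges_eq fr hv)

theorem hVector_eq_sum (hl : ∀ v ∈ vertices P, ∀ e ∈ edgesAt P v, l (fr.rdir v e) ≠ 0) {j : ℕ}
    (hj : j ≤ n) :
    hVector P j = ∑ v ∈ fr.verts, if fr.ascents l v = n - j then 1 else 0 := by
  rw [hVector]
  simp only [fVector_eq_sum hl, Nat.cast_sum, Finset.mul_sum]
  rw [Finset.sum_comm]
  refine Finset.sum_congr rfl fun v hv => ?_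
  exact sum_choose_mul_choose n _ j (ascents_le (fr.mem_verts.1 hv)) hj

/-- The Dehn–Sommerville symmetry: `h` does not depend on the functional, and replacing `l` by `-l`
exchanges ascents and descents. -/
theorem hVector_eq_sum' (hl : ∀ v ∈ vertices P, ∀ e ∈ edgesAt P v, l (fr.rdir v e) ≠ 0) {j : ℕ}
    (hj : j ≤ n) :
    hVector P j = ∑ v ∈ fr.verts, if fr.ascents l v = j then 1 else 0 := by
  rw [hVector_eq_sum (fr := fr) (l := -l) (fun v hv e he => by simpa using hl v hv e he) hj]
  refine Finset.sum_congr rfl fun v hv => ?_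
  have h := ascents_add_ascents_neg hl (fr.mem_verts.1 hv)
  exact if_congr (by omega) rfl rfl

end Framing

/-- The weight of the entry of index `a` in the symmetrized `h`-expression. -/
theorem hExpression_eq {V : Type*} (s : Finset V) (n : ℕ) (a : V → ℕ) (ha : ∀ v ∈ s, a v ≤ n)
    (h : ℕ → ℤ) (h1 : ∀ j ≤ n, h j = ∑ v ∈ s, if a v = j then 1 else 0)
    (h2 : ∀ j ≤ n, h j = ∑ v ∈ s, if a v = n - j then 1 else 0) :
    2 * hExpression n h = ∑ v ∈ s, (3 * ((n : ℤ) - 2 * a v) ^ 2 - n) := by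
  -- The sum over low indices is read in two ways: `hlow` assigns it to vertices with few ascents,
  -- `hhigh`, by symmetry, to those with many. Adding both covers the whole range of `a v`.
  have hlow : ∀ (c : ℤ → ℤ) (m : ℕ), m ≤ n →
      ∑ k ∈ Finset.Icc 1 m, c k * h (m - k) = ∑ v ∈ s, if a v < m then c (m - a v) else 0 := by
    intro c m hm
    have : ∀ k ∈ Finset.Icc 1 m, c k * h (m - k) =
        ∑ v ∈ s, if a v = m - k then c k else 0 := by
      intro k _
      rw [h1 _ (by omega), Finset.mul_sum]
      simp
    rw [Finset.sum_congr rfl this, Finset.sum_comm]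
    refine Finset.sum_congr rfl fun v _ => ?_
    split_ifs with hv
    · rw [Finset.sum_eq_single (m - a v)]
      · rw [if_pos (by omega), Nat.cast_sub hv.le]
      · intro k hk hne
        rw [Finset.mem_Icc] at hk
        exact if_neg (by omega)
      · intro hk
        rw [Finset.mem_Icc] at hk
        omega
    · refine Finset.sum_eq_zero fun k hk => ?_
      rw [Finset.mem_Icc] at hk
      exact if_neg (by omega)
  have hhigh : ∀ (c : ℤ → ℤ) (m : ℕ), m ≤ n →
      ∑ k ∈ Finset.Icc 1 m, c k * h (m - k) =
        ∑ v ∈ s, if n < m + a v then c (m + a v - n) else 0 := by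
    intro c m hm
    have : ∀ k ∈ Finset.Icc 1 m, c k * h (m - k) =
        ∑ v ∈ s, if a v = n - (m - k) then c k else 0 := by
      intro k _
      rw [h2 _ (by omega), Finset.mul_sum]
      simp
    rw [Finset.sum_congr rfl this, Finset.sum_comm]
    refine Finset.sum_congr rfl fun v hvs => ?_
    have hvn := ha v hvs
    split_ifs with hv
    · rw [Finset.sum_eq_single (m + a v - n)]
      · rw [if_pos (by omega), Nat.cast_sub hv.le]
        push_cast
        rfl
      · intro k hk hne
        rw [Finset.mem_Icc] at hk
        exact if_neg (by omega)
      · intro hk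
        rw [Finset.mem_Icc] at hk
        omega
    · refine Finset.sum_eq_zero fun k hk => ?_
      rw [Finset.mem_Icc] at hk
      exact if_neg (by omega)
  have htot : ∑ k ∈ Finset.range (n + 1), h k = ∑ v ∈ s, 1 := by
    rw [Finset.sum_congr rfl fun k hk => h1 k (Nat.lt_succ_iff.1 (Finset.mem_range.1 hk)),
      Finset.sum_comm]
    refine Finset.sum_congr rfl fun v hv => ?_
    rw [Finset.sum_ite_eq, if_pos (Finset.mem_range.2 (Nat.lt_succ_of_le (ha v hv)))]
  rw [hExpression]
  split_ifs with hn
  · obtain ⟨m, rfl⟩ := hn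
    have hm : (m + m) / 2 = m := by omega
    have e1 := hlow (fun k => k ^ 2) m (by omega)
    have e2 := hhigh (fun k => k ^ 2) m (by omega)
    rw [hm, htot, two_mul]
    -- Of the two equal copies of the expression, one is rewritten by the low form and the other by
    -- the high form.
    nth_rewrite 1 [e1]
    rw [e2]
    simp only [Finset.mul_sum, ← Finset.sum_sub_distrib, ← Finset.sum_add_distrib]
    refine Finset.sum_congr rfl fun v _ => ?_
    push_cast
    rcases lt_trichotomy (a v) m with hv | hv | hv
    · rw [if_pos hv, if_neg (by omega)]
      ring
    · rw [if_neg (by omega), if_neg (by omega), hv]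
      ring
    · rw [if_neg (by omega), if_pos (by omega)]
      ring
  · obtain ⟨m, rfl⟩ := Nat.not_even_iff_odd.1 hn
    have hm : (2 * m + 1) / 2 = m := by omega
    have e1 := hlow (fun k => k * (k + 1)) m (by omega)
    have e2 := hhigh (fun k => k * (k + 1)) m (by omega)
    rw [hm, htot, two_mul]
    nth_rewrite 1 [e1]
    rw [e2]
    simp only [Finset.mul_sum, ← Finset.sum_sub_distrib, ← Finset.sum_add_distrib]
    refine Finset.sum_congr rfl fun v _ => ?_
    push_cast
    rcases lt_or_ge (a v) m with hv | hv
    · rw [if_pos hv, if_neg (by omega)]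
      ring
    · rcases lt_or_ge (m + 1) (a v) with hv' | hv'
      · rw [if_neg (by omega), if_pos (by omega)]
        ring
      · rw [if_neg (by omega), if_neg (by omega)]
        -- For odd `n` neither sum reaches the two middle values, where `(n - 2 a v)² = 1` and the
        -- weight is `-2(m-1)`.
        have : a v = m ∨ a v = m + 1 := by omega
        rcases this with h | h <;> rw [h] <;> push_cast <;> ring

/-- The face-number expression has vertex weight `6a(a-1) + (5-3n)a`. Adding the weight for `n - a`,
obtained from `-l`, gives `3(n-2a)² - n`, the weight of the doubled `h`-expression. -/
theorem Framing.hExpression_hVector {n : ℕ} {P : Set (Fin n → ℝ)} (fr : Framing P) :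
    (hExpression n (hVector P) : ℝ) =
      12 * (fVector P 2 : ℝ) + (5 - 3 * (n : ℝ)) * (fVector P 1 : ℝ) := by
  obtain ⟨l, hl⟩ := fr.exists_generic
  have hl' : ∀ v ∈ vertices P, ∀ e ∈ edgesAt P v, (-l) (fr.rdir v e) ≠ 0 :=
    fun v hv e he => by simpa using hl v hv e he
  have h1 := hExpression_eq fr.verts n (fr.ascents l)
    (fun v hv => Framing.ascents_le (fr.mem_verts.1 hv)) (hVector P)
    (fun j hj => Framing.hVector_eq_sum' hl hj) (fun j hj => Framing.hVector_eq_sum hl hj)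
  have h1' : 2 * (hExpression n (hVector P) : ℝ) =
      ∑ v ∈ fr.verts, (3 * ((n : ℝ) - 2 * fr.ascents l v) ^ 2 - n) := by
    exact_mod_cast h1
  have hf : ∀ k : (Fin n → ℝ) →ₗ[ℝ] ℝ, (∀ v ∈ vertices P, ∀ e ∈ edgesAt P v, k (fr.rdir v e) ≠ 0) →
      12 * (fVector P 2 : ℝ) + (5 - 3 * (n : ℝ)) * (fVector P 1 : ℝ) = ∑ v ∈ fr.verts,
        (6 * (fr.ascents k v : ℝ) * (fr.ascents k v - 1) + (5 - 3 * (n : ℝ)) * fr.ascents k v) := by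
    intro k hk
    rw [Framing.fVector_eq_sum hk, Framing.fVector_eq_sum hk, Nat.cast_sum, Nat.cast_sum,
      Finset.mul_sum, Finset.mul_sum, ← Finset.sum_add_distrib]
    refine Finset.sum_congr rfl fun v _ => ?_
    rw [Nat.cast_choose_two, Nat.choose_one_right]
    ring
  have h2 : 2 * (12 * (fVector P 2 : ℝ) + (5 - 3 * (n : ℝ)) * (fVector P 1 : ℝ)) =
      ∑ v ∈ fr.verts, (3 * ((n : ℝ) - 2 * fr.ascents l v) ^ 2 - n) := by
    rw [two_mul]
    nth_rewrite 1 [hf l hl]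
    rw [hf (-l) hl', ← Finset.sum_add_distrib]
    refine Finset.sum_congr rfl fun v hv => ?_
    have h3 := Framing.ascents_add_ascents_neg hl (fr.mem_verts.1 hv)
    have h4 : (fr.ascents (-l) v : ℝ) = n - fr.ascents l v := by
      rw [eq_sub_iff_add_eq, add_comm]
      exact_mod_cast h3
    rw [h4]
    ring
  linarith

end DelzantReflexive

end

/-! ### Assembly of the theorem. -/

theorem theorem1p2 (n : ℕ) (hn : 2 ≤ n) (Δ : Set (Fin n → ℝ))
    (hpoly : DelzantReflexive.IsPolytope Δ) (hdim : DelzantReflexive.dim Δ = n)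
    (hdelzant : DelzantReflexive.IsDelzant Δ) (hreflexive : DelzantReflexive.IsReflexive Δ) :
    (∀ e ∈ DelzantReflexive.faces Δ 1,
      DelzantReflexive.IsRelativeLength e (DelzantReflexive.relativeLength e)) ∧
    ((∑ᶠ e ∈ DelzantReflexive.faces Δ 1, DelzantReflexive.relativeLength e) =
      12 * (DelzantReflexive.fVector Δ 2 : ℝ) +
        (5 - 3 * (n : ℝ)) * (DelzantReflexive.fVector Δ 1 : ℝ)) ∧
    ((∑ᶠ e ∈ DelzantReflexive.faces Δ 1, DelzantReflexive.relativeLength e) =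
      (DelzantReflexive.hExpression n (DelzantReflexive.hVector Δ) : ℝ)) := by
  obtain ⟨fr⟩ := DelzantReflexive.exists_framing hpoly hdelzant
  have hsum : (∑ᶠ e ∈ DelzantReflexive.faces Δ 1, DelzantReflexive.relativeLength e) =
      12 * (DelzantReflexive.fVector Δ 2 : ℝ) +
        (5 - 3 * (n : ℝ)) * (DelzantReflexive.fVector Δ 1 : ℝ) := by
    rw [finsum_mem_eq_finite_toFinset_sum _ (hpoly.finite_faces 1)]
    exact fr.sum_relativeLength hreflexive
  refine ⟨fun e he => ?_, hsum, by rw [hsum, fr.hExpression_hVector]⟩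
  obtain ⟨v, hv, hev⟩ := DelzantReflexive.Framing.exists_vertex_of_edge hpoly he
  rw [DelzantReflexive.Framing.relativeLength_eq_len (fr := fr) hv hev]
  exact DelzantReflexive.Framing.isRelativeLength_len hv hev
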